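/- All groups are finite, and classes of groups are closed under isomorphism. Let $\pi$ be a set of primes and $\pi'$ the complementary set of primes. Let $\mathfrak S$ and $\mathfrak N$ be the classes of solvable and of nilpotent groups, $\mathfrak G_\pi$ the class of $\pi$-groups, $\mathfrak G_p=\mathfrak G_{\{p\}}$, and $\mathfrak N_\pi$ the class of $\pi$-nilpotent groups, that is, of groups with a normal $\pi'$-subgroup whose quotient is nilpotent. A formation is a non-empty class $\mathfrak F$ of groups closed under homomorphic images and such that $G/M,\,G/N\in\mathfrak F$ implies $G/(M\cap N)\in\mathfrak F$. The residual $G^{\mathfrak F}$ is the smallest normal subgroup $N$ of $G$ with $G/N\in\mathfrak F$. For a class $\mathfrak X$ of groups, $\mathfrak X\circ\mathfrak F$ is the class of all groups $G$ with $G^{\mathfrak F}\in\mathfrak X$, $\mathrm{Int}_{\mathfrak X}(G)$ is the intersection of all $\mathfrak X$-maximal subgroups of $G$ (the maximal elements of the set of subgroups of $G$ that belong to $\mathfrak X$), and $\mathrm{Crit}_{\mathtt S}(\mathfrak X)$ is the class of all groups that are not in $\mathfrak X$ but all of whose proper subgroups are in $\mathfrak X$. Let $\mathcal N_{\pi'\mathfrak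 F}(G)=\bigcap_{H\le G}N_G\bigl(H^{\mathfrak F}O_{\pi'}(G)\bigr)$, where $O_{\pi'}(G)$ is the largest normal $\pi'$-subgroup of $G$. Put $\mathcal N^0_{\pi'\mathfrak F}(G)=1$ and $\mathcal N^{i}_{\pi'\mathfrak F}(G)/\mathcal N^{i-1}_{\pi'\mathfrak F}(G)=\mathcal N_{\pi'\mathfrak F}\bigl(G/\mathcal N^{i-1}_{\pi'\mathfrak F}(G)\bigr)$ for $i\ge1$, and let $\mathcal N^\infty_{\pi'\mathfrak F}(G)$ be the terminal term of this ascending series. For a class $\mathfrak X$ of groups, a $G$-chief factor $L/K$ is $\mathfrak X$-central in $G$ if $(L/K)\rtimes(G/C_G(L/K))\in\mathfrak X$. Let $Z_{\pi\mathfrak X}(G)$ be the product of all normal subgroups $N$ of $G$ such that every $G$-chief factor $L/K$ with $L\le N$ and order divisible by at least one prime in $\pi$ is $\mathfrak X$-central in $G$. Theorem. Let $\mathfrak F$ be a formation that is closed under taking subgroups, and let $\pi$ be a set of primes. Then the following statements are equivalent: (1) $\mathcal N^\infty_{\pi'\mathfrak F}(G)=\mathrm{Int}_{\mathfrak N_\pi\circ\mathfrak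 F}(G)$ for every $G\in\mathfrak S$. (2) $Z_{\pi(\mathfrak N\circ\mathfrak F)}(G)=\mathrm{Int}_{\mathfrak N_\pi\circ\mathfrak F}(G)$ for every $G\in\mathfrak S$. (3) For every $p\in\pi$, $\mathrm{Crit}_{\mathtt S}(\mathfrak G_p\circ\mathfrak F)\cap\mathfrak S\subseteq\mathfrak N_\pi\circ\mathfrak F$. -/

import Mathlib

universe u

/-- A class of finite groups (in the universe `u`), closed under isomorphism. -/
structure GroupClass where
  /-- Membership of a group in the class. -/
  Mem : ∀ (G : Type u) [Group G], Prop
  finite_of_mem : ∀ (G : Type u) [Group G], Mem G → Finite G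
  mem_of_mulEquiv : ∀ (G H : Type u) [Group G] [Group H], (G ≃* H) → Mem G → Mem H

namespace GroupClass

/-- The class of all finite `π`-groups, for a set `π` of primes. -/
def piGroups (π : Set Nat.Primes) : GroupClass.{u} where
  Mem G _ := Finite G ∧ ∀ p : Nat.Primes, (p : ℕ) ∣ Nat.card G → p ∈ π
  finite_of_mem _ _ h := h.1
  mem_of_mulEquiv G H _ _ e h :=
    ⟨(Equiv.finite_iff e.toEquiv).1 h.1, fun p hp => h.2 p (by rwa [Nat.card_congr e.toEquiv])⟩

/-- The class of all finite solvable groups. -/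
def solvable : GroupClass.{u} where
  Mem G _ := Finite G ∧ Group.IsSolvable G
  finite_of_mem _ _ h := h.1
  mem_of_mulEquiv _ _ _ _ e h :=
    ⟨(Equiv.finite_iff e.toEquiv).1 h.1,
      haveI := h.2
      Group.isSolvable_of_surjective (f := e.toMonoidHom) e.surjective⟩

/-- The class of all finite nilpotent groups. -/
def nilpotent : GroupClass.{u} where
  Mem G _ := Finite G ∧ Group.IsNilpotent G
  finite_of_mem _ _ h := h.1
  mem_of_mulEquiv _ _ _ _ e h :=
    ⟨(Equiv.finite_iff e.toEquiv).1 h.1,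
      haveI := h.2
      Group.nilpotent_of_mulEquiv e⟩

/-- An isomorphism `G ≃* H` induces an isomorphism of `G` modulo the preimage of `N` with `H ⧸ N`. -/
theorem nonempty_quotient_comap_mulEquiv {G H : Type u} [Group G] [Group H] (e : G ≃* H)
    (N : Subgroup H) [N.Normal] : Nonempty (G ⧸ N.comap e.toMonoidHom ≃* H ⧸ N) :=
  ⟨QuotientGroup.congr _ _ e (Subgroup.map_comap_eq_self_of_surjective e.surjective N)⟩

/-- The class of all finite `π`-nilpotent groups: extensions of a normal `π'`-subgroup by a
nilpotent group. -/
def piNilpotent (π : Set Nat.Primes) : GroupClass.{u} where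
  Mem G _ := Finite G ∧ ∃ (N : Subgroup G) (_ : N.Normal),
    (piGroups πᶜ).Mem N ∧ nilpotent.Mem (G ⧸ N)
  finite_of_mem _ _ h := h.1
  mem_of_mulEquiv G H _ _ e h := by
    obtain ⟨hG, N, hN, hN1, hN2⟩ := h
    have hM : (N.map e.toMonoidHom).Normal := hN.map _ e.surjective
    exact ⟨(Equiv.finite_iff e.toEquiv).1 hG, N.map e.toMonoidHom, hM,
      (piGroups πᶜ).mem_of_mulEquiv _ _ (e.subgroupMap N) hN1,
      nilpotent.mem_of_mulEquiv _ _ (QuotientGroup.congr N _ e rfl) hN2⟩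

variable (𝔛 𝔉 : GroupClass.{u}) (π : Set Nat.Primes)

/-- A formation: a non-empty class of groups closed under homomorphic images and subdirect
products. -/
structure IsFormation : Prop where
  nonempty : ∃ (G : Type u) (_ : Group G), 𝔉.Mem G
  mem_of_surjective : ∀ (G H : Type u) [Group G] [Group H] (f : G →* H),
    Function.Surjective f → 𝔉.Mem G → 𝔉.Mem H
  mem_quotient_inf : ∀ (G : Type u) [Group G] (M N : Subgroup G) [M.Normal] [N.Normal],
    𝔉.Mem (G ⧸ M) → 𝔉.Mem (G ⧸ N) → 𝔉.Mem (G ⧸ (M ⊓ N))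

/-- The class is closed under taking subgroups. -/
def IsSubgroupClosed : Prop :=
  ∀ (G : Type u) [Group G] (H : Subgroup G), 𝔉.Mem G → 𝔉.Mem H

/-- The `𝔉`-residual of `G`: the intersection of all normal subgroups `N` with `G ⧸ N ∈ 𝔉`.
If `𝔉` is a formation and `G` is finite, it is the smallest such `N`. -/
def residual (G : Type u) [Group G] : Subgroup G :=
  sInf {N : Subgroup G | ∃ _ : N.Normal, 𝔉.Mem (G ⧸ N)}

theorem residual_le_comap {G H : Type u} [Group G] [Group H] (e : G ≃* H) :
    𝔉.residual G ≤ (𝔉.residual H).comap e.toMonoidHom := by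
  intro x hx
  simp only [residual, Subgroup.mem_comap, Subgroup.mem_sInf, Set.mem_ofPred_eq] at hx ⊢
  rintro N ⟨hN, hNF⟩
  exact hx (N.comap e.toMonoidHom)
    ⟨inferInstance, 𝔉.mem_of_mulEquiv _ _ (nonempty_quotient_comap_mulEquiv e N).some.symm hNF⟩

theorem residual_map {G H : Type u} [Group G] [Group H] (e : G ≃* H) :
    (𝔉.residual G).map e.toMonoidHom = 𝔉.residual H := by
  apply le_antisymm
  · exact Subgroup.map_le_iff_le_comap.2 (𝔉.residual_le_comap e)
  · intro y hy
    exact ⟨e.symm y, 𝔉.residual_le_comap e.symm hy, e.apply_symm_apply y⟩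

/-- The formation product `𝔛 ∘ 𝔉`: all finite groups whose `𝔉`-residual belongs to `𝔛`. -/
def formationProduct : GroupClass.{u} where
  Mem G _ := Finite G ∧ 𝔛.Mem (𝔉.residual G)
  finite_of_mem _ _ h := h.1
  mem_of_mulEquiv G H _ _ e h := by
    refine ⟨(Equiv.finite_iff e.toEquiv).1 h.1, ?_⟩
    rw [← 𝔉.residual_map e]
    exact 𝔛.mem_of_mulEquiv _ _ (e.subgroupMap (𝔉.residual G)) h.2

/-- `O_π(G)`: the product of all normal `π`-subgroups of `G`. -/
def piRadical (G : Type u) [Group G] : Subgroup G :=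
  sSup {N : Subgroup G | N.Normal ∧ (piGroups π).Mem N}

/-- The `𝔉`-residual of a subgroup `H` of `G`, as a subgroup of `G`. -/
def subgroupResidual {G : Type u} [Group G] (H : Subgroup G) : Subgroup G :=
  (𝔉.residual H).map H.subtype

/-- The `π𝔉`-norm of `G`: the intersection of the normalizers of the products `H^𝔉 O_π(G)`, where
`H` runs over all subgroups of `G`. -/
def piNorm (G : Type u) [Group G] : Subgroup G :=
  ⨅ H : Subgroup G, Subgroup.normalizer (𝔉.subgroupResidual H ⊔ piRadical π G : Subgroup G)

theorem piRadical_map_conj {G : Type u} [Group G] (g : G) :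
    (piRadical π G).map (MulAut.conj g : G →* G) = piRadical π G := by
  have key : ∀ N ∈ {N : Subgroup G | N.Normal ∧ (piGroups π).Mem N},
      N.map (MulAut.conj g : G →* G) = N := by
    rintro N ⟨hN, -⟩
    exact Subgroup.mem_normalizer_iff_map_conj_eq.1 (by rw [Subgroup.normalizer_eq_top]; trivial)
  rw [piRadical, sSup_eq_iSup, Subgroup.map_iSup]
  refine iSup_congr fun N => ?_
  rw [Subgroup.map_iSup]
  exact iSup_congr fun hN => key N hN

theorem subgroupResidual_map_conj {G : Type u} [Group G] (g : G) (H : Subgroup G) :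
    (𝔉.subgroupResidual H).map (MulAut.conj g : G →* G) =
      𝔉.subgroupResidual (H.map (MulAut.conj g : G →* G)) := by
  have h : (𝔉.residual H).map ((MulAut.conj g).subgroupMap H).toMonoidHom =
      𝔉.residual (H.map (MulAut.conj g : G →* G)) :=
    𝔉.residual_map ((MulAut.conj g).subgroupMap H)
  rw [subgroupResidual, subgroupResidual, ← h, Subgroup.map_map, Subgroup.map_map]
  rfl

instance piNorm_normal (G : Type u) [Group G] : (piNorm 𝔉 π G).Normal := by
  refine ⟨fun x hx g => ?_⟩
  have key : ∀ H : Subgroup G,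
      (𝔉.subgroupResidual H ⊔ piRadical π G).map (MulAut.conj g : G →* G) =
        𝔉.subgroupResidual (H.map (MulAut.conj g : G →* G)) ⊔ piRadical π G := fun H => by
    rw [Subgroup.map_sup, subgroupResidual_map_conj, piRadical_map_conj]
  simp only [piNorm, Subgroup.mem_iInf] at hx ⊢
  intro H
  obtain ⟨K, rfl⟩ : ∃ K : Subgroup G, K.map (MulAut.conj g : G →* G) = H :=
    ⟨_, Subgroup.map_comap_eq_self_of_surjective (MulAut.conj g).surjective H⟩
  rw [← key, Subgroup.mem_normalizer_iff_map_conj_eq]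
  have h := Subgroup.mem_normalizer_iff_map_conj_eq.1 (hx K)
  conv_rhs => rw [← h]
  rw [Subgroup.map_map, Subgroup.map_map]
  congr 1
  ext y
  simp [mul_assoc]

/-- The upper `π𝔉`-norm series: the term of index `0` is trivial, and the term of index `i + 1`
is the preimage in `G` of the `π𝔉`-norm of `G` modulo the term of index `i`. -/
def piNormSeries (G : Type u) [Group G] : ℕ → {N : Subgroup G // N.Normal}
  | 0 => ⟨⊥, inferInstance⟩
  | i + 1 =>
    haveI := (piNormSeries G i).2
    ⟨(piNorm 𝔉 π (G ⧸ (piNormSeries G i).1)).comap (QuotientGroup.mk' (piNormSeries G i).1),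
      inferInstance⟩

/-- The terminal term of the (ascending) upper `π𝔉`-norm series of a finite group `G`. -/
def piNormInfty (G : Type u) [Group G] : Subgroup G :=
  ⨆ i : ℕ, (piNormSeries 𝔉 π G i).1

/-- The intersection of all `𝔛`-maximal subgroups of `G`. -/
def intMaximal (G : Type u) [Group G] : Subgroup G :=
  sInf {U : Subgroup G | Maximal (fun V : Subgroup G => 𝔛.Mem V) U}

/-- `L / K` is a `G`-chief factor. -/
structure IsChiefFactor {G : Type u} [Group G] (K L : Subgroup G) : Prop where
  normal_left : K.Normal
  normal_right : L.Normal
  lt : K < L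
  eq_or_eq : ∀ M : Subgroup G, M.Normal → K ≤ M → M ≤ L → M = K ∨ M = L

/-- `L / K`, realised as a subgroup of `G ⧸ K`. -/
abbrev factor {G : Type u} [Group G] (K L : Subgroup G) [K.Normal] : Subgroup (G ⧸ K) :=
  L.map (QuotientGroup.mk' K)

/-- The conjugation action of `G` on `L / K`; its kernel is `C_G(L / K)`. -/
def factorAction {G : Type u} [Group G] (K L : Subgroup G) [K.Normal] [L.Normal] :
    G →* MulAut (factor K L) :=
  haveI : (factor K L).Normal := Subgroup.Normal.map ‹_› _ (QuotientGroup.mk'_surjective K)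
  MulAut.conjNormal.comp (QuotientGroup.mk' K)

/-- The semidirect product of `L / K` with `G ⧸ C_G(L / K)` belongs to `𝔉`. -/
def IsCentralFactor {G : Type u} [Group G] (K L : Subgroup G) [K.Normal] [L.Normal] : Prop :=
  𝔉.Mem (factor K L ⋊[QuotientGroup.kerLift (factorAction K L)] (G ⧸ (factorAction K L).ker))

/-- A normal subgroup `N` of `G` is `π𝔉`-hypercentral in `G` if every `G`-chief factor below `N`
whose order is divisible by at least one prime in `π` is `𝔉`-central in `G`. -/
structure IsPiHypercentral {G : Type u} [Group G] (N : Subgroup G) : Prop where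
  normal : N.Normal
  central : ∀ (K L : Subgroup G) [K.Normal] [L.Normal], IsChiefFactor K L → L ≤ N →
    (∃ p ∈ π, (p : ℕ) ∣ Nat.card (factor K L)) → 𝔉.IsCentralFactor K L

/-- The `π𝔉`-hypercentre of `G`: the product of all `π𝔉`-hypercentral normal subgroups. -/
def piHypercentre (G : Type u) [Group G] : Subgroup G :=
  sSup {N : Subgroup G | IsPiHypercentral 𝔉 π N}

/-- `G` is `S`-critical for `𝔛`: the finite group `G` does not belong to `𝔛`, but all its proper
subgroups do. -/
def IsSCritical (G : Type u) [Group G] : Prop :=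
  Finite G ∧ ¬ 𝔛.Mem G ∧ ∀ H : Subgroup G, H < ⊤ → 𝔛.Mem H

/-- For every `p ∈ π`, every solvable group that is `S`-critical for `𝔊_p ∘ 𝔉` belongs to
`𝔑_π ∘ 𝔉`. -/
def BoundaryConditionIIISolvable : Prop :=
  ∀ p ∈ π, ∀ (G : Type u) [Group G],
    IsSCritical (formationProduct (piGroups {p}) 𝔉) G → solvable.Mem G →
      (formationProduct (piNilpotent π) 𝔉).Mem G

end GroupClass

/-! Three inclusions carry the theorem. In a finite solvable `G`, write `Z`, `N∞` and `I` for the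
hypercentre, the terminal norm and the intersection of the maximal `𝔑_π ∘ 𝔉`-subgroups. Then `Z ≤ N∞
≤ I` always holds (`piHypercentre_le_piNormInfty`, `piNormInfty_le_intMaximal`), and the boundary
condition makes `I` itself hypercentral (`isPiHypercentral_intMaximal`), so that all three coincide.
Conversely, a critical group violating the condition produces a solvable group in which `I` lies
neither in `N∞` nor in `Z` (`exists_intMaximal_not_le`).

Membership in `𝔑_π ∘ 𝔉` is tested on elements: for each `p ∈ π`, the `p'`-elements of the residual
must be closed under products (`PrimeToClosed`). This passes to images and subdirect products, and
lifts over normal `p'`-subgroups and over Frattini extensions (`primeToClosed_of_le_frattini`).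

For `N∞ ≤ I`, the point is that `p`-nilpotency of the residual lifts over a normal subgroup of the
norm: in the hard case a minimal normal `p`-subgroup `L` has a complement `M`, and `[M^𝔉, L] ≤ M ∩ L
= 1`. For `I ≤ Z`, suppose `G^𝔉` does not centralise a chief factor `L/K` below `I` with `p ∈ π`
dividing its order. A minimal `H` with `H^𝔉` not a `p`-group modulo `C_G(L/K)` is a Frattini
extension of a critical group, so it lies in a maximal `𝔑_π ∘ 𝔉`-subgroup together with `L`; there
the `p'`-elements of `H^𝔉` must centralise `L/K`, a contradiction.

For the converse, the bad critical group may be chosen to have a faithful irreducible module `V` in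
characteristic `p`. In `V ⋊ H` every maximal `𝔑_π ∘ 𝔉`-subgroup contains `V`, but if `V` were in `Z`
or `N∞` then `H^𝔉 ≠ 1` would centralise `V`. -/

namespace GroupClass

/-! ### Elements of order prime to `p` -/

section PrimeTo

variable {G Y Y' : Type*} [Group G] [Group Y] [Group Y'] {p : ℕ}

/-- The elements of `R` whose order is prime to `p` are closed under multiplication. For a finite
group `R`, this says that `R` is `p`-nilpotent. -/
def PrimeToClosed (p : ℕ) (R : Subgroup G) : Prop :=
  ∀ x ∈ R, ∀ y ∈ R, (orderOf x).Coprime p → (orderOf y).Coprime p → (orderOf (x * y)).Coprime p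

theorem coprime_orderOf_map (f : G →* Y) {x : G} (h : (orderOf x).Coprime p) :
    (orderOf (f x)).Coprime p :=
  h.coprime_dvd_left (orderOf_map_dvd f x)

theorem coprime_orderOf_of_pow {x : G} {m : ℕ} (hm : m.Coprime p)
    (h : (orderOf (x ^ m)).Coprime p) : (orderOf x).Coprime p := by
  refine (hm.mul_left h).coprime_dvd_left (orderOf_dvd_of_pow_eq_one ?_)
  rw [pow_mul, pow_orderOf_eq_one]

theorem coprime_orderOf_conj {x g : G} :
    (orderOf (g * x * g⁻¹)).Coprime p ↔ (orderOf x).Coprime p := by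
  have : orderOf (g * x * g⁻¹) = orderOf x := orderOf_injective (MulAut.conj g).toMonoidHom
    (MulAut.conj g).injective x
  rw [this]

theorem coprime_orderOf_of_card {K : Subgroup G} (hK : (Nat.card K).Coprime p) {x : G}
    (hx : x ∈ K) : (orderOf x).Coprime p :=
  hK.coprime_dvd_left (Subgroup.orderOf_dvd_natCard K hx)

/-- Every element of finite order has a power with exponent a power of `p` whose order is prime
to `p`. -/
theorem exists_coprime_orderOf_pow [Finite G] [hp : Fact p.Prime] (x : G) :
    ∃ a : ℕ, (orderOf (x ^ p ^ a)).Coprime p := by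
  obtain ⟨a, m, hm, h⟩ := Nat.exists_eq_pow_mul_and_not_dvd (orderOf_pos x).ne' p hp.out.ne_one
  refine ⟨a, Nat.Coprime.symm ((Nat.Prime.coprime_iff_not_dvd hp.out).2 fun hd => hm ?_)⟩
  refine hd.trans (orderOf_dvd_of_pow_eq_one ?_)
  rw [← pow_mul, ← h, pow_orderOf_eq_one]

/-- A power `x ^ p ^ a` has order prime to `p`; since `p ^ a` is invertible modulo the order of `f
x`, a further power restores the image. -/
theorem exists_coprime_orderOf_lift [Finite G] [hp : Fact p.Prime] (f : G →* Y) {R : Subgroup G}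
    {x : G} (hx : x ∈ R) (h : (orderOf (f x)).Coprime p) :
    ∃ x' ∈ R, f x' = f x ∧ (orderOf x').Coprime p := by
  obtain ⟨a, ha⟩ := exists_coprime_orderOf_pow (p := p) x
  obtain ⟨t, ht⟩ := exists_pow_eq_self_of_coprime (x := f x) (n := p ^ a) (h.symm.pow_left a)
  refine ⟨(x ^ p ^ a) ^ t, R.pow_mem (R.pow_mem hx _) _, ?_,
    ha.coprime_dvd_left (orderOf_pow_dvd t)⟩
  rw [map_pow, map_pow, ht]

theorem PrimeToClosed.mono {R S : Subgroup G} (h : PrimeToClosed p S) (hRS : R ≤ S) :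
    PrimeToClosed p R :=
  fun x hx y hy => h x (hRS hx) y (hRS hy)

theorem PrimeToClosed.map [Finite G] [Fact p.Prime] {R : Subgroup G} (h : PrimeToClosed p R)
    (f : G →* Y) : PrimeToClosed p (R.map f) := by
  rintro _ ⟨x, hx, rfl⟩ _ ⟨y, hy, rfl⟩ hxo hyo
  obtain ⟨x', hx', hxe, hxo'⟩ := exists_coprime_orderOf_lift f hx hxo
  obtain ⟨y', hy', hye, hyo'⟩ := exists_coprime_orderOf_lift f hy hyo
  rw [← hxe, ← hye, ← map_mul]
  exact coprime_orderOf_map f (h x' hx' y' hy' hxo' hyo')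

/-- The image under `g` is a quotient of the image under `f`; comparing kernels spares the
construction of the induced map. -/
theorem PrimeToClosed.map_of_ker_le [Finite G] [Fact p.Prime] {R : Subgroup G} {f : G →* Y}
    {g : G →* Y'} (h : PrimeToClosed p (R.map f)) (hfg : f.ker ≤ g.ker) :
    PrimeToClosed p (R.map g) := by
  rintro _ ⟨x, hx, rfl⟩ _ ⟨y, hy, rfl⟩ hxo hyo
  obtain ⟨x', hx', hxe, hxo'⟩ := exists_coprime_orderOf_lift g hx hxo
  obtain ⟨y', hy', hye, hyo'⟩ := exists_coprime_orderOf_lift g hy hyo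
  rw [← hxe, ← hye, ← map_mul]
  have := h (f x') ⟨x', hx', rfl⟩ (f y') ⟨y', hy', rfl⟩ (coprime_orderOf_map f hxo')
    (coprime_orderOf_map f hyo')
  rw [← map_mul] at this
  refine this.coprime_dvd_left (orderOf_dvd_of_pow_eq_one ?_)
  rw [← map_pow, ← MonoidHom.mem_ker]
  exact hfg (by rw [MonoidHom.mem_ker, map_pow, pow_orderOf_eq_one])

theorem eq_one_of_isPGroup_of_coprime {R : Subgroup G} (h : IsPGroup p R) {x : G} (hx : x ∈ R)
    (hxo : (orderOf x).Coprime p) : x = 1 := by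
  obtain ⟨k, hk⟩ := h ⟨x, hx⟩
  have hk' : x ^ p ^ k = 1 := by simpa [Subtype.ext_iff] using hk
  exact orderOf_eq_one_iff.1 (Nat.eq_one_of_dvd_coprimes (hxo.symm.pow_left k)
    (orderOf_dvd_of_pow_eq_one hk') dvd_rfl)

/-- A power of `x * y` with exponent prime to `p` falls into the kernel, whose elements are
`p'`-elements. -/
theorem PrimeToClosed.of_map_of_ker {R : Subgroup G} {f : G →* Y}
    (h : PrimeToClosed p (R.map f)) (hk : (Nat.card f.ker).Coprime p) : PrimeToClosed p R := by
  intro x hx y hy hxo hyo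
  have := h (f x) ⟨x, hx, rfl⟩ (f y) ⟨y, hy, rfl⟩ (coprime_orderOf_map f hxo)
    (coprime_orderOf_map f hyo)
  rw [← map_mul] at this
  refine coprime_orderOf_of_pow this (coprime_orderOf_of_card hk ?_)
  rw [MonoidHom.mem_ker, map_pow, pow_orderOf_eq_one]

theorem PrimeToClosed.of_map_of_injective {R : Subgroup G} {f : G →* Y}
    (h : PrimeToClosed p (R.map f)) (hf : Function.Injective f) : PrimeToClosed p R :=
  h.of_map_of_ker (by rw [(MonoidHom.ker_eq_bot_iff f).2 hf]; simp)

theorem PrimeToClosed.of_map_of_map {R : Subgroup G} {f : G →* Y} {f' : G →* Y'}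
    (h : PrimeToClosed p (R.map f)) (h' : PrimeToClosed p (R.map f')) (hk : f.ker ⊓ f'.ker = ⊥) :
    PrimeToClosed p R := by
  refine PrimeToClosed.of_map_of_injective (f := f.prod f') ?_ ?_
  · rintro _ ⟨x, hx, rfl⟩ _ ⟨y, hy, rfl⟩ hxo hyo
    have h1 := h (f x) ⟨x, hx, rfl⟩ (f y) ⟨y, hy, rfl⟩
      (coprime_orderOf_map (MonoidHom.fst Y Y') hxo) (coprime_orderOf_map (MonoidHom.fst Y Y') hyo)
    have h2 := h' (f' x) ⟨x, hx, rfl⟩ (f' y) ⟨y, hy, rfl⟩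
      (coprime_orderOf_map (MonoidHom.snd Y Y') hxo) (coprime_orderOf_map (MonoidHom.snd Y Y') hyo)
    refine (h1.mul_left h2).coprime_dvd_left (orderOf_dvd_of_pow_eq_one ?_)
    ext
    · simp [pow_mul, ← map_mul, pow_orderOf_eq_one]
    · rw [mul_comm]
      simp [pow_mul, ← map_mul, pow_orderOf_eq_one]
  · rw [← MonoidHom.ker_eq_bot_iff, MonoidHom.ker_prod, hk]

theorem PrimeToClosed.of_isPGroup {R : Subgroup G} (h : IsPGroup p R) :
    PrimeToClosed p R := by
  intro x hx y hy hxo hyo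
  rw [eq_one_of_isPGroup_of_coprime h hx hxo, eq_one_of_isPGroup_of_coprime h hy hyo]
  simp

/-- The elements of `R` whose order is prime to `p`, as a subgroup. -/
def PrimeToClosed.subgroup {R : Subgroup G} (h : PrimeToClosed p R) : Subgroup G where
  carrier := {x | x ∈ R ∧ (orderOf x).Coprime p}
  one_mem' := ⟨R.one_mem, by simp⟩
  mul_mem' hx hy := ⟨R.mul_mem hx.1 hy.1, h _ hx.1 _ hy.1 hx.2 hy.2⟩
  inv_mem' hx := ⟨R.inv_mem hx.1, by simpa using hx.2⟩

theorem PrimeToClosed.normal_subgroup {R : Subgroup G} (h : PrimeToClosed p R) [R.Normal] :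
    h.subgroup.Normal :=
  ⟨fun x hx g => ⟨Subgroup.Normal.conj_mem ‹_› x hx.1 g, coprime_orderOf_conj.2 hx.2⟩⟩

theorem coprime_card_of_forall_orderOf [Finite G] [hp : Fact p.Prime] {K : Subgroup G}
    (h : ∀ x ∈ K, (orderOf x).Coprime p) : (Nat.card K).Coprime p := by
  refine Nat.Coprime.symm ((Nat.Prime.coprime_iff_not_dvd hp.out).2 fun hd => ?_)
  obtain ⟨x, hx⟩ := exists_prime_orderOf_dvd_card' p hd
  have := h x x.2
  rw [Subgroup.orderOf_coe, hx, Nat.coprime_self] at this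
  exact hp.out.ne_one this

/-- The group is the product of its Sylow subgroups; the projection onto the Sylow `p`-subgroup has
a kernel of order prime to `p`. -/
theorem primeToClosed_top_of_isNilpotent [Finite G] [hp : Fact p.Prime] [hG : Group.IsNilpotent G] :
    PrimeToClosed p (⊤ : Subgroup G) := by
  by_cases hd : p ∣ Nat.card G
  · obtain ⟨e⟩ := ((Group.isNilpotent_of_finite_tfae (G := G)).out 0 4).1 hG
    let P : Sylow p G := default
    let q : (Nat.card G).primeFactors :=
      ⟨p, Nat.mem_primeFactors.2 ⟨hp.out, hd, Nat.card_pos.ne'⟩⟩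
    let f : G →* P := (Pi.evalMonoidHom _ P).comp ((Pi.evalMonoidHom _ q).comp e.symm.toMonoidHom)
    have hf : Function.Surjective f :=
      (Function.surjective_eval P).comp ((Function.surjective_eval q).comp e.symm.surjective)
    have hc : Nat.card f.ker = (P : Subgroup G).index := by
      have h1 := f.ker.card_mul_index
      rw [Subgroup.index_ker, MonoidHom.range_eq_top.2 hf, Subgroup.card_top,
        ← (P : Subgroup G).index_mul_card] at h1
      exact Nat.eq_of_mul_eq_mul_right Nat.card_pos h1
    refine PrimeToClosed.of_map_of_ker (f := f) ?_ ?_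
    · exact PrimeToClosed.of_isPGroup ((P.2.to_subgroup _))
    · rw [hc]
      exact Nat.Coprime.symm ((Nat.Prime.coprime_iff_not_dvd hp.out).2 P.not_dvd_index)
  · intro x _ y _ _ _
    exact (Nat.Coprime.symm ((Nat.Prime.coprime_iff_not_dvd hp.out).2 hd)).coprime_dvd_left
      (orderOf_dvd_natCard _)

theorem primeToClosed_of_isNilpotent [Finite G] [hp : Fact p.Prime] (N : Subgroup G)
    [hG : Group.IsNilpotent N] : PrimeToClosed p N := by
  have := (primeToClosed_top_of_isNilpotent (p := p) (G := N)).map N.subtype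
  rwa [← MonoidHom.range_eq_map, Subgroup.range_subtype] at this

/-- A finite group that is `p`-nilpotent for all primes `p ∈ π` is `π`-nilpotent, and conversely. -/
theorem piNilpotent_mem_iff {π : Set Nat.Primes} {R : Type u} [Group R] [Finite R] :
    (piNilpotent π).Mem R ↔ ∀ p ∈ π, PrimeToClosed (p : ℕ) (⊤ : Subgroup R) := by
  constructor
  · rintro ⟨-, N, hN, hN1, hN2⟩ p hp
    have : Fact (p : ℕ).Prime := ⟨p.2⟩
    have := hN2.2
    refine PrimeToClosed.of_map_of_ker (f := QuotientGroup.mk' N)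
      (primeToClosed_top_of_isNilpotent.mono le_top) ?_
    rw [QuotientGroup.ker_mk']
    exact Nat.Coprime.symm ((Nat.Prime.coprime_iff_not_dvd p.2).2 fun hd => hN1.2 p hd hp)
  · intro h
    let S : Subgroup R := ⨅ p : π, (h p p.2).subgroup
    have hSn : S.Normal := Subgroup.normal_iInf_normal fun p => (h p p.2).normal_subgroup
    refine ⟨inferInstance, S, hSn, ⟨inferInstance, fun p hp hpπ => ?_⟩, inferInstance, ?_⟩
    · have : Fact (p : ℕ).Prime := ⟨p.2⟩
      have hc : (Nat.card S).Coprime p := coprime_card_of_forall_orderOf fun x hx =>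
        ((Subgroup.mem_iInf.1 hx) ⟨p, hpπ⟩).2
      exact (Nat.Prime.coprime_iff_not_dvd p.2).1 hc.symm hp
    -- The lower central series becomes stationary. Its last term lies in every `p`-complement,
    -- because the quotient by the complement is a `p`-group, hence nilpotent; so it lies in `S`.
    · obtain ⟨n, hn⟩ := WellFoundedGT.monotone_chain_condition
        (⟨fun n => OrderDual.toDual (Subgroup.lowerCentralSeries (⊤ : Subgroup R) n),
          Subgroup.lowerCentralSeries_antitone _⟩ : ℕ →o (Subgroup R)ᵒᵈ)
      have hle : Subgroup.lowerCentralSeries (⊤ : Subgroup R) n ≤ S := by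
        refine le_iInf fun p => ?_
        have : Fact (p : ℕ).Prime := ⟨p.1.2⟩
        have := (h p p.2).normal_subgroup
        have hpg : IsPGroup (p : ℕ) (R ⧸ (h p p.2).subgroup) := by
          intro x
          obtain ⟨x, rfl⟩ := QuotientGroup.mk_surjective x
          obtain ⟨a, ha⟩ := exists_coprime_orderOf_pow (p := p) x
          exact ⟨a, by
            rw [← QuotientGroup.mk_pow, QuotientGroup.eq_one_iff]
            exact ⟨trivial, ha⟩⟩
        obtain ⟨m, hm⟩ := Subgroup.nilpotent_iff_lowerCentralSeries.1 hpg.isNilpotent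
        have h1 : Subgroup.lowerCentralSeries (⊤ : Subgroup R) n ≤
            Subgroup.lowerCentralSeries (⊤ : Subgroup R) m := by
          rcases le_total n m with hnm | hnm
          · exact (OrderDual.toDual_inj.1 (hn m hnm)).le
          · exact Subgroup.lowerCentralSeries_antitone _ hnm
        refine h1.trans ?_
        rw [← QuotientGroup.ker_mk' (h p p.2).subgroup, ← MonoidHom.comap_bot,
          ← Subgroup.map_le_iff_le_comap, Subgroup.map_lowerCentralSeries, ← hm]
        exact Subgroup.lowerCentralSeries_mono m le_top
      rw [Subgroup.nilpotent_iff_lowerCentralSeries]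
      refine ⟨n, ?_⟩
      rw [← Subgroup.map_top_of_surjective _ (QuotientGroup.mk'_surjective S),
        ← Subgroup.map_lowerCentralSeries, eq_bot_iff, Subgroup.map_le_iff_le_comap,
        MonoidHom.comap_bot, QuotientGroup.ker_mk']
      exact hle

end PrimeTo

/-! ### Residuals of hereditary formations -/

section Residual

variable {𝔉 : GroupClass.{u}} {G H : Type u} [Group G] [Group H]

instance residual_normal : (𝔉.residual G).Normal :=
  ⟨fun x hx g => by
    simp only [residual, Subgroup.mem_sInf] at hx ⊢
    rintro N hN
    obtain ⟨hNn, _⟩ := id hN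
    exact hNn.conj_mem x (hx N hN) g⟩

theorem residual_le_of_mem {N : Subgroup G} [hN : N.Normal] (h : 𝔉.Mem (G ⧸ N)) :
    𝔉.residual G ≤ N :=
  sInf_le ⟨hN, h⟩

theorem IsFormation.mem_of_subsingleton (h𝔉 : 𝔉.IsFormation) [Subsingleton G] : 𝔉.Mem G := by
  obtain ⟨E, _, hE⟩ := h𝔉.nonempty
  exact h𝔉.mem_of_surjective E G 1 (fun x => ⟨1, Subsingleton.elim _ _⟩) hE

theorem IsFormation.mem_quotient_residual (h𝔉 : 𝔉.IsFormation) [Finite G] :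
    𝔉.Mem (G ⧸ 𝔉.residual G) := by
  have hfin : {N : Subgroup G | ∃ _ : N.Normal, 𝔉.Mem (G ⧸ N)}.Finite := Set.toFinite _
  have hne : {N : Subgroup G | ∃ _ : N.Normal, 𝔉.Mem (G ⧸ N)}.Nonempty := by
    have : Subsingleton (G ⧸ (⊤ : Subgroup G)) := QuotientGroup.subsingleton_quotient_top
    exact ⟨⊤, inferInstance, h𝔉.mem_of_subsingleton⟩
  obtain ⟨N, hN⟩ := hfin.exists_minimal hne
  obtain ⟨hNn, hNF⟩ := hN.prop
  have hle : N ≤ 𝔉.residual G := by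
    refine le_sInf ?_
    rintro M ⟨hM, hMF⟩
    exact (hN.le_of_le ⟨inferInstance, h𝔉.mem_quotient_inf G M N hMF hNF⟩ inf_le_right).trans
      inf_le_left
  exact h𝔉.mem_of_surjective _ _ (QuotientGroup.map N (𝔉.residual G) (MonoidHom.id G) hle)
    (QuotientGroup.map_surjective_of_surjective _ _ _ (QuotientGroup.mk_surjective) _) hNF

theorem IsFormation.mem_quotient_iff (h𝔉 : 𝔉.IsFormation) [Finite G] {N : Subgroup G} [N.Normal] :
    𝔉.Mem (G ⧸ N) ↔ 𝔉.residual G ≤ N := by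
  refine ⟨residual_le_of_mem, fun hle => ?_⟩
  exact h𝔉.mem_of_surjective _ _ (QuotientGroup.map (𝔉.residual G) N (MonoidHom.id G) hle)
    (QuotientGroup.map_surjective_of_surjective _ _ _ (QuotientGroup.mk_surjective) _)
    h𝔉.mem_quotient_residual

theorem IsFormation.mem_iff_residual_eq_bot (h𝔉 : 𝔉.IsFormation) [Finite G] :
    𝔉.Mem G ↔ 𝔉.residual G = ⊥ := by
  rw [← le_bot_iff, ← h𝔉.mem_quotient_iff]
  exact ⟨𝔉.mem_of_mulEquiv _ _ (QuotientGroup.quotientBot (G := G)).symm,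
    𝔉.mem_of_mulEquiv _ _ (QuotientGroup.quotientBot (G := G))⟩

theorem residual_le_ker (hS : 𝔉.IsSubgroupClosed) (f : G →* H) (h : 𝔉.Mem H) :
    𝔉.residual G ≤ f.ker :=
  residual_le_of_mem (𝔉.mem_of_mulEquiv _ _ (QuotientGroup.quotientKerEquivRange f).symm
    (hS H f.range h))

/-- Here `f` need not be surjective: its image modulo the residual of `H` is a subgroup of a group
in `𝔉`. This is where closure under subgroups enters. -/
theorem IsFormation.map_residual_le (h𝔉 : 𝔉.IsFormation) (hS : 𝔉.IsSubgroupClosed) [Finite H]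
    (f : G →* H) : (𝔉.residual G).map f ≤ 𝔉.residual H := by
  rw [Subgroup.map_le_iff_le_comap]
  refine (residual_le_ker hS ((QuotientGroup.mk' (𝔉.residual H)).comp f)
    h𝔉.mem_quotient_residual).trans ?_
  rw [← MonoidHom.comap_ker, QuotientGroup.ker_mk']

theorem IsFormation.map_residual (h𝔉 : 𝔉.IsFormation) [Finite G] (f : G →* H)
    (hf : Function.Surjective f) : (𝔉.residual G).map f = 𝔉.residual H := by
  apply le_antisymm
  · rw [Subgroup.map_le_iff_le_comap]
    intro x hx
    simp only [residual, Subgroup.mem_comap, Subgroup.mem_sInf, Set.mem_ofPred_eq] at hx ⊢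
    rintro N ⟨hN, hNF⟩
    refine hx (N.comap f) ⟨inferInstance, ?_⟩
    refine 𝔉.mem_of_mulEquiv _ _ (QuotientGroup.congr _ _ (MulEquiv.refl _) ?_)
      (𝔉.mem_of_mulEquiv _ _ (QuotientGroup.quotientKerEquivOfSurjective
        ((QuotientGroup.mk' N).comp f) ((QuotientGroup.mk'_surjective N).comp hf)).symm hNF)
    rw [← MonoidHom.comap_ker, QuotientGroup.ker_mk']
    exact Subgroup.map_id _
  · have : ((𝔉.residual G).map f).Normal := Subgroup.Normal.map inferInstance f hf
    refine residual_le_of_mem (h𝔉.mem_of_surjective _ _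
      (QuotientGroup.map (𝔉.residual G) _ f (Subgroup.le_comap_map _ _))
      (QuotientGroup.map_surjective_of_surjective _ _ _
        ((QuotientGroup.mk_surjective).comp hf) _) h𝔉.mem_quotient_residual)

/-- The residual of the image of a homomorphism is the image of the residual. -/
theorem IsFormation.subgroupResidual_range (h𝔉 : 𝔉.IsFormation) [Finite G] (f : G →* H) :
    𝔉.subgroupResidual f.range = (𝔉.residual G).map f := by
  rw [subgroupResidual, ← h𝔉.map_residual f.rangeRestrict f.rangeRestrict_surjective,
    Subgroup.map_map]
  rfl

theorem IsFormation.subgroupResidual_map (h𝔉 : 𝔉.IsFormation) [Finite G] (f : G →* H)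
    (U : Subgroup G) : 𝔉.subgroupResidual (U.map f) = (𝔉.subgroupResidual U).map f := by
  have := h𝔉.subgroupResidual_range (f.comp U.subtype)
  rw [← Subgroup.map_map, MonoidHom.range_comp, Subgroup.range_subtype] at this
  exact this

theorem IsFormation.subgroupResidual_mono (h𝔉 : 𝔉.IsFormation) (hS : 𝔉.IsSubgroupClosed) [Finite G]
    {U W : Subgroup G} (h : U ≤ W) : 𝔉.subgroupResidual U ≤ 𝔉.subgroupResidual W := by
  have := h𝔉.map_residual_le hS (Subgroup.inclusion h)
  have := Subgroup.map_mono (f := W.subtype) this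
  rwa [Subgroup.map_map] at this

theorem IsFormation.subgroupResidual_le_residual (h𝔉 : 𝔉.IsFormation) (hS : 𝔉.IsSubgroupClosed)
    [Finite G] (U : Subgroup G) : 𝔉.subgroupResidual U ≤ 𝔉.residual G :=
  h𝔉.map_residual_le hS U.subtype

theorem subgroupResidual_le (U : Subgroup G) : 𝔉.subgroupResidual U ≤ U :=
  Subgroup.map_subtype_le _

theorem IsFormation.subgroupResidual_top (h𝔉 : 𝔉.IsFormation) [Finite G] :
    𝔉.subgroupResidual (⊤ : Subgroup G) = 𝔉.residual G := by
  have := h𝔉.subgroupResidual_range (MonoidHom.id G)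
  rwa [MonoidHom.range_eq_top.2 Function.surjective_id, Subgroup.map_id] at this

/-! ### Membership in the formation products -/

theorem primeToClosed_top_iff {p : ℕ} {K : Subgroup G} [Finite G] [Fact p.Prime] :
    PrimeToClosed p (⊤ : Subgroup K) ↔ PrimeToClosed p K := by
  have e : (⊤ : Subgroup K).map K.subtype = K := by
    rw [← MonoidHom.range_eq_map, Subgroup.range_subtype]
  refine ⟨fun h => ?_, fun h => ?_⟩
  · have := h.map K.subtype
    rwa [e] at this
  · refine PrimeToClosed.of_map_of_injective (f := K.subtype) ?_ K.subtype_injective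
    rwa [e]

theorem mem_piNilpotent_product_iff {π : Set Nat.Primes} [Finite G] :
    (formationProduct (piNilpotent π) 𝔉).Mem G ↔
      ∀ p ∈ π, PrimeToClosed (p : ℕ) (𝔉.residual G) := by
  refine ((and_iff_right ‹_›).trans piNilpotent_mem_iff).trans ?_
  refine forall₂_congr fun p hp => ?_
  have : Fact (p : ℕ).Prime := ⟨p.2⟩
  exact primeToClosed_top_iff

theorem mem_piNilpotent_product_subgroup_iff {π : Set Nat.Primes} [Finite G] {U : Subgroup G} :
    (formationProduct (piNilpotent π) 𝔉).Mem U ↔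
      ∀ p ∈ π, PrimeToClosed (p : ℕ) (𝔉.subgroupResidual U) := by
  rw [mem_piNilpotent_product_iff]
  refine forall₂_congr fun p hp => ?_
  have : Fact (p : ℕ).Prime := ⟨p.2⟩
  exact ⟨fun h => h.map U.subtype, fun h => h.of_map_of_injective U.subtype_injective⟩

theorem mem_pGroups_product_iff {p : Nat.Primes} [Finite G] :
    (formationProduct (piGroups {p}) 𝔉).Mem G ↔ IsPGroup (p : ℕ) (𝔉.residual G) := by
  have : Fact (p : ℕ).Prime := ⟨p.2⟩
  refine (and_iff_right ‹_›).trans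
    ((and_iff_right (inferInstance : Finite (𝔉.residual G))).trans ?_)
  constructor
  · intro h
    rw [IsPGroup.iff_card]
    refine ⟨_, Nat.eq_prime_pow_of_unique_prime_dvd Nat.card_pos.ne' fun {q} hq hqd => ?_⟩
    exact congrArg Subtype.val (h ⟨q, hq⟩ hqd)
  · intro h q hq
    obtain ⟨n, hn⟩ := IsPGroup.iff_card.1 h
    rw [hn] at hq
    exact Subtype.ext ((Nat.prime_dvd_prime_iff_eq q.2 p.2).1 (q.2.dvd_of_dvd_pow hq))

theorem mem_pGroups_product_subgroup_iff {p : Nat.Primes} [Finite G] {U : Subgroup G} :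
    (formationProduct (piGroups {p}) 𝔉).Mem U ↔ IsPGroup (p : ℕ) (𝔉.subgroupResidual U) := by
  rw [mem_pGroups_product_iff]
  exact ⟨fun h => h.map U.subtype, fun h => h.of_equiv
    ((𝔉.residual U).equivMapOfInjective U.subtype U.subtype_injective).symm⟩

end Residual

/-! ### Minimal normal subgroups -/

section MinimalNormal

variable {G : Type*} [Group G]

/-- `L` is a minimal normal subgroup. -/
def IsMinimalNormal (L : Subgroup G) : Prop :=
  Minimal (fun N : Subgroup G => N.Normal ∧ N ≠ ⊥) L

theorem exists_isMinimalNormal_le [Finite G] {K : Subgroup G} (hK : K.Normal) (h : K ≠ ⊥) :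
    ∃ L ≤ K, IsMinimalNormal L :=
  (Set.toFinite {N : Subgroup G | N.Normal ∧ N ≠ ⊥}).exists_le_minimal ⟨hK, h⟩

theorem IsMinimalNormal.normal {L : Subgroup G} (hL : IsMinimalNormal L) : L.Normal :=
  hL.prop.1

theorem IsMinimalNormal.ne_bot {L : Subgroup G} (hL : IsMinimalNormal L) : L ≠ ⊥ :=
  hL.prop.2

theorem IsMinimalNormal.eq_bot_or_eq {L : Subgroup G} (hL : IsMinimalNormal L) {N : Subgroup G}
    (hN : N.Normal) (hle : N ≤ L) : N = ⊥ ∨ N = L := by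
  by_cases h : N = ⊥
  · exact .inl h
  · exact .inr (hL.eq_of_le ⟨hN, h⟩ hle)

theorem IsMinimalNormal.inf_eq_bot_or_le {L : Subgroup G} (hL : IsMinimalNormal L) {N : Subgroup G}
    (hN : N.Normal) : N ⊓ L = ⊥ ∨ L ≤ N := by
  have := hL.normal
  rcases hL.eq_bot_or_eq (N := N ⊓ L) inferInstance inf_le_right with h | h
  · exact .inl h
  · exact .inr (inf_eq_right.1 h)

theorem IsMinimalNormal.commute [Group.IsSolvable G] {L : Subgroup G} (hL : IsMinimalNormal L) :
    ∀ x ∈ L, ∀ y ∈ L, x * y = y * x := by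
  have := hL.normal
  have h : ⁅L, L⁆ = ⊥ := by
    have hlt : ⁅L, L⁆ < L := Group.IsSolvable.commutator_lt_of_ne_bot hL.ne_bot
    exact (hL.eq_bot_or_eq inferInstance hlt.le).resolve_right hlt.ne
  intro x hx y hy
  have := Subgroup.commutator_mem_commutator hx hy
  rw [h, Subgroup.mem_bot] at this
  exact commutatorElement_eq_one_iff_mul_comm.1 this

/-- `L` is abelian, so its elements killed by a prime `q` form a normal subgroup of `G`; by Cauchy
it is nontrivial when `q` divides the order of `L`, so it is all of `L`. -/
theorem IsMinimalNormal.exists_isPGroup [Finite G] [Group.IsSolvable G] {L : Subgroup G}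
    (hL : IsMinimalNormal L) : ∃ q : ℕ, q.Prime ∧ IsPGroup q L := by
  have hn := hL.normal
  have hc := hL.commute
  have hne : Nat.card L ≠ 1 := fun h => hL.ne_bot (Subgroup.card_eq_one.1 h)
  obtain ⟨q, hq, hqd⟩ := Nat.exists_prime_and_dvd hne
  have : Fact q.Prime := ⟨hq⟩
  let Ω : Subgroup G :=
    { carrier := {x | x ∈ L ∧ x ^ q = 1}
      one_mem' := ⟨L.one_mem, one_pow q⟩
      mul_mem' := fun {x y} hx hy => ⟨L.mul_mem hx.1 hy.1, by
        rw [(show Commute x y from hc x hx.1 y hy.1).mul_pow, hx.2, hy.2, one_mul]⟩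
      inv_mem' := fun {x} hx => ⟨L.inv_mem hx.1, by rw [inv_pow, hx.2, inv_one]⟩ }
  have hΩn : Ω.Normal := ⟨fun x hx g => ⟨hn.conj_mem x hx.1 g, by rw [conj_pow, hx.2]; simp⟩⟩
  have hΩ : Ω = L := by
    refine (hL.eq_bot_or_eq hΩn fun x hx => hx.1).resolve_left fun hb => ?_
    obtain ⟨x, hx⟩ := exists_prime_orderOf_dvd_card' q hqd
    have hxΩ : (x : G) ∈ Ω := ⟨x.2, by
      rw [← Subgroup.orderOf_coe] at hx
      rw [← hx, pow_orderOf_eq_one]⟩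
    rw [hb, Subgroup.mem_bot] at hxΩ
    rw [← Subgroup.orderOf_coe, hxΩ, orderOf_one] at hx
    exact hq.ne_one hx.symm
  refine ⟨q, hq, isPGroup_iff_pow_pow_eq_one.2 fun x => ⟨1, ?_⟩⟩
  have hx : (x : G) ∈ Ω := by rw [hΩ]; exact x.2
  exact Subtype.ext (by simpa using hx.2)

/-- In a finite solvable group, a minimal normal subgroup outside the Frattini subgroup has a
complement. -/
theorem IsMinimalNormal.exists_isCompl [Finite G] [Group.IsSolvable G] {L : Subgroup G}
    (hL : IsMinimalNormal L) (h : ¬ L ≤ frattini G) : ∃ M : Subgroup G, M ⊓ L = ⊥ ∧ M ⊔ L = ⊤ := by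
  have hn := hL.normal
  have : ∃ M : Subgroup G, IsCoatom M ∧ ¬ L ≤ M := by
    by_contra! hc
    exact h (le_iInf₂ hc)
  obtain ⟨M, hM, hLM⟩ := this
  have hsup : M ⊔ L = ⊤ := hM.2 _ (left_lt_sup.2 hLM)
  refine ⟨M, ?_, hsup⟩
  -- `M` normalises the intersection since `L` is normal, `L` centralises it since `L` is abelian,
  -- and together they generate `G`.
  have hnorm : (M ⊓ L).Normal := by
    rw [← Subgroup.normalizer_eq_top_iff, eq_top_iff, ← hsup, sup_le_iff]
    constructor
    · intro m hm
      rw [Subgroup.mem_normalizer_iff]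
      intro x
      exact ⟨fun hx => ⟨M.mul_mem (M.mul_mem hm hx.1) (M.inv_mem hm), hn.conj_mem x hx.2 m⟩,
        fun hx => ⟨by
          have := M.mul_mem (M.mul_mem (M.inv_mem hm) hx.1) hm
          simpa [mul_assoc] using this, by
          have := hn.conj_mem _ hx.2 m⁻¹
          simpa [mul_assoc] using this⟩⟩
    · intro l hl
      rw [Subgroup.mem_normalizer_iff]
      intro x
      have key : ∀ x ∈ L, l * x * l⁻¹ = x := fun x hx => by
        rw [hL.commute l hl x hx, mul_inv_cancel_right]
      constructor
      · intro hx
        rwa [key x hx.2]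
      · intro hx
        have hxL : x ∈ L := by
          have := hn.conj_mem _ hx.2 l⁻¹
          simpa [mul_assoc] using this
        rwa [key x hxL] at hx
  refine (hL.eq_bot_or_eq hnorm inf_le_right).resolve_right fun he => hLM ?_
  exact inf_eq_right.1 he

theorem commute_of_inf_eq_bot {M N : Subgroup G} (hM : M.Normal) (hN : N.Normal)
    (h : M ⊓ N = ⊥) {x y : G} (hx : x ∈ M) (hy : y ∈ N) : x * y = y * x :=
  Subgroup.commute_of_normal_of_disjoint M N hM hN (disjoint_iff.2 h) x y hx hy

theorem coprime_card_of_isPGroup_of_ne [Finite G] {p q : ℕ} (hp : p.Prime) (hq : q.Prime)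
    {L : Subgroup G} (hL : IsPGroup q L) (hpq : q ≠ p) : (Nat.card L).Coprime p := by
  have : Fact q.Prime := ⟨hq⟩
  obtain ⟨n, hn⟩ := IsPGroup.iff_card.1 hL
  rw [hn]
  exact ((Nat.coprime_primes hq hp).2 hpq).pow_left n

end MinimalNormal

/-! ### Frattini extensions -/

section Frattini

variable {𝔉 : GroupClass.{u}}

theorem IsFormation.map_mk_residual (h𝔉 : 𝔉.IsFormation) {G : Type u} [Group G]
    [Finite G] {K : Subgroup G} [K.Normal] {Y : Type*} [Group Y] (f : G ⧸ K →* Y) :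
    (𝔉.residual (G ⧸ K)).map f = (𝔉.residual G).map (f.comp (QuotientGroup.mk' K)) := by
  rw [← h𝔉.map_residual (QuotientGroup.mk' K) (QuotientGroup.mk'_surjective K), Subgroup.map_map]

/-- If the residual of the quotient `G ⧸ K` is `p`-nilpotent and `K` is a `p'`-group, then the
residual of `G` is `p`-nilpotent. -/
theorem IsFormation.primeToClosed_of_quotient (h𝔉 : 𝔉.IsFormation) {G : Type u} [Group G] [Finite G]
    {p : ℕ} {K : Subgroup G} [K.Normal] (hK : (Nat.card K).Coprime p)
    (h : PrimeToClosed p (𝔉.residual (G ⧸ K))) : PrimeToClosed p (𝔉.residual G) := by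
  rw [← h𝔉.map_residual (QuotientGroup.mk' K) (QuotientGroup.mk'_surjective K)] at h
  exact h.of_map_of_ker (by rwa [QuotientGroup.ker_mk'])

/-- The double quotient is an image of `G ⧸ N`. This carries the hypothesis to `G ⧸ K` in inductions
on the group order. -/
theorem IsFormation.primeToClosed_residual_quotient_map (h𝔉 : 𝔉.IsFormation) {G : Type u} [Group G]
    [Finite G] {p : ℕ} [Fact p.Prime] {K N : Subgroup G} [K.Normal] [N.Normal]
    [(N.map (QuotientGroup.mk' K)).Normal] (h : PrimeToClosed p (𝔉.residual (G ⧸ N))) :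
    PrimeToClosed p (𝔉.residual ((G ⧸ K) ⧸ N.map (QuotientGroup.mk' K))) := by
  rw [← h𝔉.map_residual (QuotientGroup.mk' N) (QuotientGroup.mk'_surjective N)] at h
  rw [← h𝔉.map_residual (QuotientGroup.mk' _) (QuotientGroup.mk'_surjective _),
    h𝔉.map_mk_residual]
  refine h.map_of_ker_le ?_
  rw [QuotientGroup.ker_mk', ← MonoidHom.comap_ker, QuotientGroup.ker_mk']
  exact Subgroup.le_comap_map _ _

theorem card_quotient_lt {G : Type*} [Group G] [Finite G] {K : Subgroup G} (hK : K ≠ ⊥) :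
    Nat.card (G ⧸ K) < Nat.card G := by
  have h1 := K.card_eq_card_quotient_mul_card_subgroup
  have h2 : 1 < Nat.card K := by
    rw [Subgroup.one_lt_card_iff_ne_bot]; exact hK
  have h3 : 0 < Nat.card (G ⧸ K) := Nat.card_pos
  nlinarith

/-- A normal subgroup of order a power of `q` modulo the Frattini subgroup contains a normal
`q`-subgroup of the whole group that is nontrivial modulo the Frattini subgroup. -/
theorem exists_normal_isPGroup_of_map {G Y : Type*} [Group G] [Finite G] [Group Y] (f : G →* Y)
    (hker : f.ker ≤ frattini G) {q : ℕ} [Fact q.Prime] {L : Subgroup G} [hLn : L.Normal]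
    (hkL : f.ker ≤ L) (hL : IsPGroup q (L.map f)) (hne : L.map f ≠ ⊥) :
    ∃ Q : Subgroup G, Q.Normal ∧ Q ≠ ⊥ ∧ IsPGroup q Q := by
  let P : Sylow q L := default
  let Q : Subgroup G := (P : Subgroup L).map L.subtype
  have hQp : IsPGroup q Q := P.isPGroup'.map _
  have hQL : Q ≤ L := Subgroup.map_subtype_le _
  have hsup : Q ⊔ f.ker = L := by
    refine le_antisymm (sup_le hQL hkL) ?_
    -- The index of the image of `P` is a power of `q`, yet divides the index of `P`, which is prime
    -- to `q`.
    have hmap : Q.map f = L.map f := by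
      let g : L →* L.map f := f.subgroupMap L
      have hg : Function.Surjective g := f.subgroupMap_surjective L
      have : Finite (L.map f) := Finite.of_surjective g hg
      have h1 : ((P : Subgroup L).map g).index ∣ (P : Subgroup L).index :=
        Subgroup.index_map_dvd _ hg
      obtain ⟨n, hn⟩ := (hL.index ((P : Subgroup L).map g))
      have h2 : ((P : Subgroup L).map g).index = 1 := by
        rcases Nat.eq_zero_or_pos n with h0 | h0
        · rw [hn, h0, pow_zero]
        · exact absurd ((dvd_pow_self q h0.ne').trans (hn ▸ h1)) P.not_dvd_index
      have h3 : (P : Subgroup L).map g = ⊤ := Subgroup.index_eq_one.1 h2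
      have h4 := congrArg (Subgroup.map (L.map f).subtype) h3
      rw [Subgroup.map_map, ← MonoidHom.range_eq_map, Subgroup.range_subtype] at h4
      rw [← h4, Subgroup.map_map]
      rfl
    rw [← Subgroup.comap_map_eq, hmap]
    exact Subgroup.le_comap_map f L
  -- Frattini argument: the normaliser of `Q` and `L` generate `G`. As `L = Q ⊔ f.ker` and `f.ker`
  -- lies in the Frattini subgroup, the normaliser alone is `G`.
  have hfr := Sylow.normalizer_sup_eq_top P
  have hQn : Subgroup.normalizer (Q : Set G) = ⊤ := by
    refine frattini_nongenerating ?_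
    rw [eq_top_iff, ← hfr]
    refine sup_le le_sup_left ?_
    rw [← hsup]
    exact sup_le (Subgroup.le_normalizer.trans le_sup_left) (hker.trans le_sup_right)
  refine ⟨Q, Subgroup.normalizer_eq_top_iff.1 hQn, ?_, hQp⟩
  intro hb
  rw [hb, bot_sup_eq] at hsup
  exact hne (by rw [← hsup, Subgroup.map_eq_bot_iff])

/-- The class of solvable groups with `p`-nilpotent `𝔉`-residual is closed under Frattini
extensions. -/
theorem IsFormation.primeToClosed_of_le_frattini (h𝔉 : 𝔉.IsFormation) {p : ℕ} [hp : Fact p.Prime]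
    {G : Type u} [Group G] [Finite G] [Group.IsSolvable G] {N : Subgroup G} [N.Normal]
    (hN : N ≤ frattini G) (h : PrimeToClosed p (𝔉.residual (G ⧸ N))) :
    PrimeToClosed p (𝔉.residual G) := by
  induction hn : Nat.card G using Nat.strong_induction_on generalizing G with
  | _ n ih =>
  subst hn
  have hmap := h𝔉.map_residual (QuotientGroup.mk' N) (QuotientGroup.mk'_surjective N)
  by_cases hK : ∃ K : Subgroup G, K.Normal ∧ K ≠ ⊥ ∧ (Nat.card K).Coprime p
  · obtain ⟨K, hKn, hK1, hKp⟩ := hK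
    refine h𝔉.primeToClosed_of_quotient hKp ?_
    have hNn : (N.map (QuotientGroup.mk' K)).Normal :=
      Subgroup.Normal.map ‹_› _ (QuotientGroup.mk'_surjective K)
    refine ih _ (card_quotient_lt hK1) (N := N.map (QuotientGroup.mk' K)) ?_ ?_ rfl
    · rw [Subgroup.map_le_iff_le_comap]
      exact hN.trans (frattini_le_comap_frattini_of_surjective (QuotientGroup.mk'_surjective K))
    · exact h𝔉.primeToClosed_residual_quotient_map h
  · have := h.normal_subgroup
    -- Otherwise the `p'`-elements of the residual of `G ⧸ N` contain a minimal normal `q`-subgroup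
    -- with `q ≠ p`, which forces a nontrivial normal `q`-subgroup of `G`, excluded in this case.
    have hbot : h.subgroup = ⊥ := by
      by_contra hne
      obtain ⟨L, hLle, hL⟩ := exists_isMinimalNormal_le this hne
      obtain ⟨q, hq, hLq⟩ := hL.exists_isPGroup
      have hqf : Fact q.Prime := ⟨hq⟩
      have hLn := hL.normal
      have hqp : q ≠ p := by
        rintro rfl
        refine hL.ne_bot ((Subgroup.eq_bot_iff_forall _).2 fun x hx => ?_)
        exact eq_one_of_isPGroup_of_coprime hLq hx (hLle hx).2
      have hLm : (L.comap (QuotientGroup.mk' N)).map (QuotientGroup.mk' N) = L :=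
        Subgroup.map_comap_eq_self_of_surjective (QuotientGroup.mk'_surjective N) L
      obtain ⟨Q, hQn, hQ1, hQq⟩ := exists_normal_isPGroup_of_map (QuotientGroup.mk' N)
        (by rwa [QuotientGroup.ker_mk']) (q := q) (L := L.comap (QuotientGroup.mk' N))
        (Subgroup.ker_le_comap _ _) (by rwa [hLm]) (by rw [hLm]; exact hL.ne_bot)
      exact hK ⟨Q, hQn, hQ1, coprime_card_of_isPGroup_of_ne hp.out hq hQq hqp⟩
    have hle : ∀ x ∈ 𝔉.residual G, (orderOf x).Coprime p → x ∈ frattini G := by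
      intro x hx hxo
      refine hN ?_
      rw [← QuotientGroup.eq_one_iff, ← Subgroup.mem_bot, ← hbot]
      exact ⟨hmap ▸ Subgroup.mem_map_of_mem (QuotientGroup.mk' N) hx,
        coprime_orderOf_map (QuotientGroup.mk' N) hxo⟩
    have : Group.IsNilpotent (frattini G) := frattini_nilpotent
    intro x hx y hy hxo hyo
    exact primeToClosed_of_isNilpotent (frattini G) x (hle x hx hxo) y (hle y hy hyo) hxo hyo

end Frattini

/-! ### The `π`-radical and the `π𝔉`-norm -/

section Norm

variable {𝔉 : GroupClass.{u}} {π : Set Nat.Primes} {G H : Type u} [Group G] [Group H]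

theorem mem_piGroups_of_card_dvd [Finite G] [Finite H] (h : (piGroups π).Mem G)
    (hd : Nat.card H ∣ Nat.card G) : (piGroups π).Mem H :=
  ⟨inferInstance, fun p hp => h.2 p (hp.trans hd)⟩

theorem mem_piGroups_sup [Finite G] {M N : Subgroup G} [N.Normal] (hM : (piGroups π).Mem M)
    (hN : (piGroups π).Mem N) : (piGroups π).Mem (M ⊔ N : Subgroup G) := by
  refine ⟨inferInstance, fun p hp => ?_⟩
  rw [← Subgroup.relIndex_bot_left, ← Subgroup.relIndex_mul_relIndex _ _ _ bot_le
    (le_sup_right : N ≤ M ⊔ N), Subgroup.relIndex_sup_right, Subgroup.relIndex_bot_left] at hp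
  rcases (Nat.Prime.dvd_mul p.2).1 hp with h | h
  · exact hN.2 p h
  · exact hM.2 p (h.trans (Subgroup.relIndex_dvd_card _ _))

theorem le_piRadical {N : Subgroup G} (hN : N.Normal) (h : (piGroups π).Mem N) :
    N ≤ piRadical π G :=
  le_sSup ⟨hN, h⟩

instance piRadical_normal : (piRadical π G).Normal := by
  rw [← Subgroup.normalizer_eq_top_iff, Subgroup.eq_top_iff']
  exact fun g => Subgroup.mem_normalizer_iff_map_conj_eq.2 (piRadical_map_conj π g)

theorem piRadical_mem [Finite G] : (piGroups π).Mem (piRadical π G) := by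
  have hbot : (piGroups π).Mem (⊥ : Subgroup G) := ⟨inferInstance, fun p hp => by
    rw [Subgroup.card_bot] at hp
    exact absurd (Nat.dvd_one.1 hp) p.2.ne_one⟩
  obtain ⟨M, hM⟩ := (Set.toFinite {N : Subgroup G | N.Normal ∧ (piGroups π).Mem N}).exists_maximal
    ⟨⊥, inferInstance, hbot⟩
  obtain ⟨hMn, hMp⟩ := hM.prop
  have : piRadical π G = M := by
    refine le_antisymm (sSup_le ?_) (le_piRadical hMn hMp)
    rintro N ⟨hN, hNp⟩
    exact le_sup_left.trans (hM.le_of_ge ⟨inferInstance, mem_piGroups_sup hNp hMp⟩ le_sup_right)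
  rwa [this]

theorem map_piRadical_le [Finite G] (f : G →* H) (hf : Function.Surjective f) :
    (piRadical π G).map f ≤ piRadical π H := by
  have : Finite H := Finite.of_surjective f hf
  exact le_piRadical (Subgroup.Normal.map inferInstance f hf)
    (mem_piGroups_of_card_dvd piRadical_mem (Subgroup.card_map_dvd _ f))

theorem comap_piRadical_le [Finite G] (W : Subgroup G) :
    (piRadical π G).comap W.subtype ≤ piRadical π W :=
  le_piRadical inferInstance (mem_piGroups_of_card_dvd piRadical_mem
    (Subgroup.card_comap_dvd_of_injective _ W.subtype W.subtype_injective))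

theorem mem_piNorm_iff {x : G} : x ∈ piNorm 𝔉 π G ↔ ∀ U : Subgroup G,
    x ∈ Subgroup.normalizer (𝔉.subgroupResidual U ⊔ piRadical π G : Subgroup G) :=
  Subgroup.mem_iInf

theorem piRadical_le_piNorm : piRadical π G ≤ piNorm 𝔉 π G :=
  le_iInf fun _ => le_sup_right.trans Subgroup.le_normalizer

theorem mem_normalizer_sup {G : Type*} [Group G] {A B : Subgroup G} {x : G}
    (hA : x ∈ Subgroup.normalizer (A : Set G)) (hB : x ∈ Subgroup.normalizer (B : Set G)) :
    x ∈ Subgroup.normalizer ((A ⊔ B : Subgroup G) : Set G) := by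
  rw [Subgroup.mem_normalizer_iff_map_conj_eq] at *
  rw [Subgroup.map_sup, hA, hB]

theorem mem_normalizer_of_normal {G : Type*} [Group G] {A : Subgroup G} [A.Normal] {x : G} :
    x ∈ Subgroup.normalizer (A : Set G) := by
  rw [Subgroup.normalizer_eq_top]; trivial

/-- Test against the preimage of each subgroup of `H`. The image of `O_π(G)` may be smaller than
`O_π(H)`, so the latter is joined afterwards; being normal, it does no harm. -/
theorem IsFormation.map_piNorm_le (h𝔉 : 𝔉.IsFormation) [Finite G] (f : G →* H)
    (hf : Function.Surjective f) : (piNorm 𝔉 π G).map f ≤ piNorm 𝔉 π H := by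
  rintro _ ⟨x, hx, rfl⟩
  refine mem_piNorm_iff.2 fun U => ?_
  have h1 := (Subgroup.le_normalizer_map f)
    (Subgroup.mem_map_of_mem f (mem_piNorm_iff.1 hx (U.comap f)))
  rw [Subgroup.map_sup, ← h𝔉.subgroupResidual_map,
    Subgroup.map_comap_eq_self_of_surjective hf] at h1
  have h2 := mem_normalizer_sup h1 (mem_normalizer_of_normal (A := piRadical π H))
  rwa [sup_assoc, sup_eq_right.2 (map_piRadical_le f hf)] at h2

theorem IsFormation.comap_piNorm_le (h𝔉 : 𝔉.IsFormation) [Finite G] (W : Subgroup G) :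
    (piNorm 𝔉 π G).comap W.subtype ≤ piNorm 𝔉 π W := by
  intro x hx
  refine mem_piNorm_iff.2 fun U => ?_
  have h1 := (Subgroup.le_normalizer_comap W.subtype)
    (show x ∈ Subgroup.comap W.subtype _ from mem_piNorm_iff.1 hx (U.map W.subtype))
  -- Dedekind's law, the residual of `U` being inside `W`.
  have h2 : (𝔉.subgroupResidual (U.map W.subtype) ⊔ piRadical π G).comap W.subtype =
      𝔉.subgroupResidual U ⊔ (piRadical π G).comap W.subtype := by
    rw [h𝔉.subgroupResidual_map]
    ext y
    rw [Subgroup.mem_comap, Subgroup.mem_sup_of_normal_right, Subgroup.mem_sup_of_normal_right]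
    constructor
    · rintro ⟨_, ⟨r, hr, rfl⟩, o, ho, hy⟩
      refine ⟨r, hr, r⁻¹ * y, ?_, by simp⟩
      have : W.subtype (r⁻¹ * y) = o := by rw [map_mul, ← hy]; simp
      rwa [Subgroup.mem_comap, this]
    · rintro ⟨r, hr, o, ho, rfl⟩
      exact ⟨r, Subgroup.mem_map_of_mem _ hr, o, ho, by simp⟩
  rw [h2] at h1
  have h3 := mem_normalizer_sup h1 (mem_normalizer_of_normal (A := piRadical π W))
  rwa [sup_assoc, sup_eq_right.2 (comap_piRadical_le W)] at h3

end Norm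

/-! ### Central chief factors -/

section Central

/-- If `⁅V, R⁆` were not trivial, it would equal `V`, and `V` would lie in every term of the lower
central series of `R`. -/
theorem IsMinimalNormal.commutator_eq_bot {G : Type*} [Group G] {V R : Subgroup G}
    (hV : IsMinimalNormal V) [R.Normal] [hR : Group.IsNilpotent R] : ⁅V, R⁆ = ⊥ := by
  have := hV.normal
  refine (hV.eq_bot_or_eq inferInstance (Subgroup.commutator_le_left V R)).resolve_right fun h => ?_
  obtain ⟨n, hn⟩ := (Subgroup.isNilpotent_iff_lowerCentralSeries R).1 hR
  have key : ∀ m, V ≤ R.lowerCentralSeries m := by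
    intro m
    induction m with
    | zero =>
      rw [← h]
      simpa using Subgroup.commutator_le_right V R
    | succ m ih =>
      rw [← h]
      exact Subgroup.commutator_mono ih le_rfl
  exact hV.ne_bot (le_bot_iff.1 (hn ▸ key n))

theorem isNilpotent_of_commute {G : Type*} [Group G] (h : ∀ x y : G, x * y = y * x) :
    Group.IsNilpotent G :=
  Subgroup.isNilpotent_of_ker_le_center (1 : G →* Unit)
    (fun x _ => Subgroup.mem_center_iff.2 fun y => h y x)

variable {𝔉 : GroupClass.{u}} {G : Type u} [Group G] {K L : Subgroup G} [K.Normal] [L.Normal]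

instance factor_normal : (factor K L).Normal :=
  Subgroup.Normal.map ‹_› _ (QuotientGroup.mk'_surjective K)

theorem mk_mem_factor_iff {K L : Subgroup G} [K.Normal] (hKL : K ≤ L) {x : G} :
    (x : G ⧸ K) ∈ factor K L ↔ x ∈ L := by
  have h : (factor K L).comap (QuotientGroup.mk' K) = L := by
    rw [Subgroup.comap_map_eq, QuotientGroup.ker_mk', sup_eq_left.2 hKL]
  exact (show _ ↔ x ∈ (factor K L).comap (QuotientGroup.mk' K) from Iff.rfl).trans (by rw [h])

theorem mem_ker_factorAction_iff {g : G} :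
    g ∈ (factorAction K L).ker ↔ ∀ l ∈ L, g * l * g⁻¹ * l⁻¹ ∈ K := by
  rw [MonoidHom.mem_ker]
  constructor
  · intro h l hl
    have := congrArg Subtype.val (DFunLike.congr_fun h
      (⟨(l : G ⧸ K), Subgroup.mem_map_of_mem (QuotientGroup.mk' K) hl⟩ : factor K L))
    have h2 : ((g * l * g⁻¹ : G) : G ⧸ K) = (l : G ⧸ K) := this
    rw [← QuotientGroup.eq_one_iff, QuotientGroup.mk_mul, h2, QuotientGroup.mk_inv, mul_inv_cancel]
  · intro h
    ext ⟨_, l, hl, rfl⟩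
    have h2 : ((g * l * g⁻¹ : G) : G ⧸ K) = (l : G ⧸ K) := by
      have := (QuotientGroup.eq_one_iff _).2 (h l hl)
      rwa [QuotientGroup.mk_mul, QuotientGroup.mk_inv, mul_inv_eq_one] at this
    exact h2

theorem IsChiefFactor.isMinimalNormal (h : IsChiefFactor K L) : IsMinimalNormal (factor K L) := by
  refine ⟨⟨inferInstance, fun hb => ?_⟩, ?_⟩
  · rw [Subgroup.map_eq_bot_iff, QuotientGroup.ker_mk'] at hb
    exact h.lt.not_ge hb
  · rintro N ⟨hN, hN1⟩ hle
    have hKN : K ≤ N.comap (QuotientGroup.mk' K) :=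
      (QuotientGroup.ker_mk' K).ge.trans (Subgroup.ker_le_comap _ _)
    have hNL : N.comap (QuotientGroup.mk' K) ≤ L := fun x hx =>
      (mk_mem_factor_iff h.lt.le).1 (hle hx)
    have hNm := Subgroup.map_comap_eq_self_of_surjective (QuotientGroup.mk'_surjective K) N
    rcases h.eq_or_eq _ inferInstance hKN hNL with he | he
    · refine absurd ?_ hN1
      rw [← hNm, he, Subgroup.map_eq_bot_iff, QuotientGroup.ker_mk']
    · rw [factor, ← he, hNm]

/-- A chief factor `L / K` of a solvable group `G` is `𝔑 ∘ 𝔉`-central if and only if it is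
centralised by the `𝔉`-residual of `G`. -/
theorem IsFormation.isCentralFactor_iff (h𝔉 : 𝔉.IsFormation) [Finite G] [Group.IsSolvable G]
    (h : IsChiefFactor K L) :
    (formationProduct nilpotent 𝔉).IsCentralFactor K L ↔ 𝔉.residual G ≤ (factorAction K L).ker := by
  have hmin := h.isMinimalNormal
  have hcomm := hmin.commute
  have : Finite (factor K L ⋊[QuotientGroup.kerLift (factorAction K L)]
      (G ⧸ (factorAction K L).ker)) :=
    Finite.of_equiv _ SemidirectProduct.equivProd.symm
  -- The right-hand side is moved to the semidirect product: it says that the residual there lies in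
  -- the kernel of the projection, the copy of `L / K`.
  rw [← h𝔉.mem_quotient_iff, h𝔉.mem_iff_residual_eq_bot,
    ← h𝔉.map_residual (SemidirectProduct.rightHom
      (φ := QuotientGroup.kerLift (factorAction K L))) SemidirectProduct.rightHom_surjective,
    Subgroup.map_eq_bot_iff]
  set ψ := QuotientGroup.kerLift (factorAction K L) with hψ
  have hcomm' : ∀ a b : factor K L, a * b = b * a := fun a b =>
    Subtype.ext (hcomm a a.2 b b.2)
  refine (and_iff_right this).trans
    ((and_iff_right (inferInstance : Finite (𝔉.residual _))).trans ?_)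
  constructor
  · intro hnil
    -- The copy of `L / K` is still minimal normal, so the nilpotent residual centralises it; as the
    -- action of the complement is faithful, the residual projects to the identity.
    let V : Subgroup (factor K L ⋊[ψ] (G ⧸ (factorAction K L).ker)) :=
      (SemidirectProduct.inl (φ := ψ)).range
    have hVn : V.Normal := by
      change (SemidirectProduct.inl (φ := ψ)).range.Normal
      rw [SemidirectProduct.range_inl_eq_ker_rightHom]
      infer_instance
    have hV : IsMinimalNormal V := by
      refine ⟨⟨hVn, fun hb => hmin.ne_bot ?_⟩, ?_⟩
      · rw [Subgroup.eq_bot_iff_forall]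
        intro x hx
        have : SemidirectProduct.inl (φ := ψ) ⟨x, hx⟩ ∈ V := ⟨_, rfl⟩
        rw [hb, Subgroup.mem_bot, ← map_one SemidirectProduct.inl,
          SemidirectProduct.inl_inj] at this
        exact congrArg Subtype.val this
      · rintro N ⟨hN, hN1⟩ hle
        let M : Subgroup (G ⧸ K) :=
          (N.comap (SemidirectProduct.inl (φ := ψ))).map (factor K L).subtype
        have hM : M.Normal := by
          refine ⟨?_⟩
          rintro _ ⟨x, hx, rfl⟩ g
          obtain ⟨g, rfl⟩ := QuotientGroup.mk_surjective g
          refine ⟨factorAction K L g x, ?_, rfl⟩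
          have := hN.conj_mem _ hx (SemidirectProduct.inr (g : G ⧸ (factorAction K L).ker))
          rw [← map_inv, ← SemidirectProduct.inl_aut] at this
          exact this
        rcases hmin.eq_bot_or_eq hM (Subgroup.map_subtype_le _) with he | he
        · refine absurd ?_ hN1
          rw [Subgroup.eq_bot_iff_forall]
          intro y hy
          obtain ⟨x, rfl⟩ := hle hy
          have hx : (x : G ⧸ K) ∈ M := ⟨x, hy, rfl⟩
          rw [he, Subgroup.mem_bot] at hx
          rw [show x = 1 from Subtype.ext hx, map_one]
        · rintro _ ⟨x, rfl⟩
          have hx : (x : G ⧸ K) ∈ M := he.ge x.2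
          obtain ⟨x', hx', hxe⟩ := hx
          rw [← show x' = x from Subtype.ext hxe]
          exact hx'
    have : Group.IsNilpotent (𝔉.residual (factor K L ⋊[ψ] (G ⧸ (factorAction K L).ker))) := hnil
    have hVR := hV.commutator_eq_bot (R := 𝔉.residual _)
    intro r hr
    rw [MonoidHom.mem_ker]
    refine (injective_iff_map_eq_one ψ).1 (QuotientGroup.kerLift_injective _) _ ?_
    ext1 v
    have hc := Subgroup.commutator_mem_commutator
      (show SemidirectProduct.inl v ∈ V from ⟨v, rfl⟩) hr
    rw [hVR, Subgroup.mem_bot, commutatorElement_eq_one_iff_mul_comm] at hc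
    have hl := congrArg SemidirectProduct.left hc
    simp only [SemidirectProduct.mul_left, SemidirectProduct.left_inl, SemidirectProduct.right_inl,
      map_one, MulAut.one_apply] at hl
    rw [hcomm' v] at hl
    exact (mul_left_cancel hl).symm
  · intro hle
    rw [← SemidirectProduct.range_inl_eq_ker_rightHom] at hle
    refine isNilpotent_of_commute ?_
    rintro ⟨x, hx⟩ ⟨y, hy⟩
    obtain ⟨a, rfl⟩ := hle hx
    obtain ⟨b, rfl⟩ := hle hy
    exact Subtype.ext (by simp [← map_mul, hcomm' a b])

end Central

section Series

variable {𝔉 : GroupClass.{u}} {π : Set Nat.Primes} {G : Type u} [Group G]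

/-! ### The upper `π𝔉`-norm series -/

instance piNormSeries_normal (i : ℕ) : (piNormSeries 𝔉 π G i).1.Normal :=
  (piNormSeries 𝔉 π G i).2

theorem mem_piNormSeries_succ_iff {i : ℕ} {x : G} : x ∈ (piNormSeries 𝔉 π G (i + 1)).1 ↔
    (x : G ⧸ (piNormSeries 𝔉 π G i).1) ∈ piNorm 𝔉 π (G ⧸ (piNormSeries 𝔉 π G i).1) :=
  Iff.rfl

theorem piNormSeries_monotone : Monotone fun i => (piNormSeries 𝔉 π G i).1 := by
  refine monotone_nat_of_le_succ fun i x hx => ?_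
  rw [mem_piNormSeries_succ_iff, (QuotientGroup.eq_one_iff x).2 hx]
  exact one_mem _

theorem exists_piNormInfty_eq [Finite G] :
    ∃ n, ∀ m, n ≤ m → (piNormSeries 𝔉 π G m).1 = piNormInfty 𝔉 π G := by
  obtain ⟨n, hn⟩ := WellFoundedGT.monotone_chain_condition
    (⟨fun i => (piNormSeries 𝔉 π G i).1, piNormSeries_monotone⟩ : ℕ →o Subgroup G)
  have hle : ∀ i, (piNormSeries 𝔉 π G i).1 ≤ (piNormSeries 𝔉 π G n).1 := fun i => by
    rcases le_total n i with h | h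
    · exact (hn i h).ge
    · exact piNormSeries_monotone h
  refine ⟨n, fun m hm => le_antisymm (le_iSup (fun i => (piNormSeries 𝔉 π G i).1) m)
    (iSup_le fun i => (hle i).trans (hn m hm).le)⟩

/-! ### The hypercentre is contained in the terminal term of the norm series -/

/-- If the norm of `G ⧸ D` is trivial, then `D` contains every hypercentral normal subgroup. -/
theorem IsFormation.isPiHypercentral_le (h𝔉 : 𝔉.IsFormation) (hS : 𝔉.IsSubgroupClosed)
    [Finite G] [Group.IsSolvable G] {N D : Subgroup G} [hD : D.Normal]
    (hN : IsPiHypercentral (formationProduct nilpotent 𝔉) π N)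
    (hmem : ∀ x : G, (x : G ⧸ D) ∈ piNorm 𝔉 πᶜ (G ⧸ D) → x ∈ D) : N ≤ D := by
  have hNn := hN.normal
  by_contra hND
  have hn1 : (N.map (QuotientGroup.mk' D)).Normal :=
    Subgroup.Normal.map hNn _ (QuotientGroup.mk'_surjective D)
  obtain ⟨L', hL'N, hL'⟩ := exists_isMinimalNormal_le hn1 (by
    rwa [Ne, Subgroup.map_eq_bot_iff, QuotientGroup.ker_mk'])
  have hL'n := hL'.normal
  let L : Subgroup G := L'.comap (QuotientGroup.mk' D)
  have hLn : L.Normal := inferInstance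
  have hmap : L.map (QuotientGroup.mk' D) = L' :=
    Subgroup.map_comap_eq_self_of_surjective (QuotientGroup.mk'_surjective D) L'
  have hDL : D ≤ L := (QuotientGroup.ker_mk' D).ge.trans (Subgroup.ker_le_comap _ _)
  have hnot : ¬ L' ≤ piNorm 𝔉 πᶜ (G ⧸ D) := fun hle => hL'.ne_bot (by
    rw [← hmap, Subgroup.map_eq_bot_iff, QuotientGroup.ker_mk']
    exact fun x hx => hmem x (hle hx))
  have hcover : ∀ x ∈ L, ∃ y ∈ L ⊓ N, ∃ d ∈ D, x = y * d := by
    intro x hx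
    obtain ⟨y, hy, hyx⟩ := hL'N (show (x : G ⧸ D) ∈ L' from hx)
    have hd : y⁻¹ * x ∈ D := QuotientGroup.eq.1 hyx
    refine ⟨y, ⟨?_, hy⟩, y⁻¹ * x, hd, by simp⟩
    have := L.mul_mem hx (L.inv_mem (hDL hd))
    simpa using this
  -- Hypercentrality of `N` only concerns factors below `N`, so `L / D` is replaced by the
  -- isomorphic factor `(L ⊓ N) / (D ⊓ N)`.
  have hchief : IsChiefFactor (D ⊓ N) (L ⊓ N) := by
    refine ⟨inferInstance, inferInstance, lt_of_le_of_ne (inf_le_inf_right _ hDL) fun he => ?_, ?_⟩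
    · refine hL'.ne_bot ?_
      rw [← hmap, Subgroup.map_eq_bot_iff, QuotientGroup.ker_mk']
      intro x hx
      obtain ⟨y, hy, d, hd, rfl⟩ := hcover x hx
      rw [← he] at hy
      exact D.mul_mem hy.1 hd
    · intro M hM hDM hML
      have hMn : (M.map (QuotientGroup.mk' D)).Normal :=
        Subgroup.Normal.map hM _ (QuotientGroup.mk'_surjective D)
      have hMN : M ≤ N := hML.trans inf_le_right
      rcases hL'.eq_bot_or_eq hMn (hmap ▸ Subgroup.map_mono (hML.trans inf_le_left)) with he | he
      · left
        rw [Subgroup.map_eq_bot_iff, QuotientGroup.ker_mk'] at he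
        exact le_antisymm (le_inf he hMN) hDM
      · right
        refine le_antisymm hML fun x hx => ?_
        have hx' : (x : G ⧸ D) ∈ M.map (QuotientGroup.mk' D) := he ▸ hx.1
        obtain ⟨m, hm, hmx⟩ := hx'
        have hd : m⁻¹ * x ∈ D ⊓ N :=
          ⟨QuotientGroup.eq.1 hmx, N.mul_mem (N.inv_mem (hMN hm)) hx.2⟩
        have := M.mul_mem hm (hDM hd)
        simpa using this
  by_cases hp : ∃ p ∈ π, (p : ℕ) ∣ Nat.card L'
  · obtain ⟨p, hp, hpd⟩ := hp
    have hcard : Nat.card (factor (D ⊓ N) (L ⊓ N)) = Nat.card L' := by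
      rw [← hmap, factor, ← Subgroup.relIndex_ker, ← Subgroup.relIndex_ker, QuotientGroup.ker_mk',
        QuotientGroup.ker_mk']
      have h1 : (L ⊓ N) ⊔ D = L := le_antisymm (sup_le inf_le_left hDL) fun x hx => by
        obtain ⟨y, hy, d, hd, rfl⟩ := hcover x hx
        exact Subgroup.mul_mem_sup hy hd
      rw [← h1, Subgroup.relIndex_sup_right, h1, ← Subgroup.inf_relIndex_right D (L ⊓ N)]
      congr 1
      rw [← inf_assoc, inf_eq_left.2 hDL]
    have hcen := (h𝔉.isCentralFactor_iff hchief).1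
      (hN.central _ _ hchief inf_le_right ⟨p, hp, by rwa [hcard]⟩)
    refine hnot fun x hx => mem_piNorm_iff.2 fun U => mem_normalizer_sup ?_ mem_normalizer_of_normal
    have hcomm : ∀ r ∈ 𝔉.subgroupResidual U, r * x = x * r := by
      intro r hr
      replace hr := h𝔉.subgroupResidual_le_residual hS U hr
      rw [← h𝔉.map_residual (QuotientGroup.mk' D) (QuotientGroup.mk'_surjective D)] at hr
      obtain ⟨r, hr, rfl⟩ := hr
      rw [← hmap] at hx
      obtain ⟨x, hx, rfl⟩ := hx
      obtain ⟨y, hy, d, hd, rfl⟩ := hcover x hx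
      have h2 : QuotientGroup.mk' D (y * d) = (y : G ⧸ D) :=
        QuotientGroup.eq.2 (by simpa using D.inv_mem hd)
      rw [h2]
      have h3 := (QuotientGroup.eq_one_iff _).2 (mem_ker_factorAction_iff.1 (hcen hr) y hy).1
      rw [QuotientGroup.mk_mul, QuotientGroup.mk_mul, QuotientGroup.mk_mul, QuotientGroup.mk_inv,
        QuotientGroup.mk_inv, mul_inv_eq_one, mul_inv_eq_iff_eq_mul] at h3
      exact h3
    exact Subgroup.centralizer_le_normalizer _ (Subgroup.mem_centralizer_iff.2 hcomm)
  · push Not at hp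
    refine hnot ((le_piRadical (π := πᶜ) hL'n ⟨inferInstance, fun p hpd hpπ => ?_⟩).trans
      piRadical_le_piNorm)
    exact hp p hpπ hpd

theorem IsFormation.piHypercentre_le_piNormInfty (h𝔉 : 𝔉.IsFormation) (hS : 𝔉.IsSubgroupClosed)
    [Finite G] [Group.IsSolvable G] :
    piHypercentre (formationProduct nilpotent 𝔉) π G ≤ piNormInfty 𝔉 πᶜ G := by
  obtain ⟨n, hn⟩ := exists_piNormInfty_eq (𝔉 := 𝔉) (π := πᶜ) (G := G)
  have hsucc : (piNormSeries 𝔉 πᶜ G (n + 1)).1 = (piNormSeries 𝔉 πᶜ G n).1 :=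
    (hn _ n.le_succ).trans (hn n le_rfl).symm
  rw [← hn n le_rfl]
  exact sSup_le fun N hN => h𝔉.isPiHypercentral_le hS hN fun x hx =>
    hsucc ▸ mem_piNormSeries_succ_iff.2 hx

end Series

section NormInMaximal

variable {𝔉 : GroupClass.{u}} {π : Set Nat.Primes}

/-! ### The norm series is contained in the maximal `𝔑_π ∘ 𝔉`-subgroups -/

theorem subgroup_le_normalizer_subgroupResidual {G : Type u} [Group G] (M : Subgroup G) :
    M ≤ Subgroup.normalizer (𝔉.subgroupResidual M : Set G) := by
  have := Subgroup.le_normalizer_map (H := 𝔉.residual M) M.subtype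
  rwa [Subgroup.normalizer_eq_top, ← MonoidHom.range_eq_map, Subgroup.range_subtype] at this

/-- If the residual of `G` is `p`-nilpotent modulo a normal subgroup that is contained in the
norm, then it is `p`-nilpotent. -/
theorem IsFormation.primeToClosed_of_le_piNorm (h𝔉 : 𝔉.IsFormation) {p : Nat.Primes} (hp : p ∈ π)
    {G : Type u} [Group G] [Finite G] [Group.IsSolvable G] {D : Subgroup G} [D.Normal]
    (hD : D ≤ piNorm 𝔉 πᶜ G) (h : PrimeToClosed (p : ℕ) (𝔉.residual (G ⧸ D))) :
    PrimeToClosed (p : ℕ) (𝔉.residual G) := by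
  have hpf : Fact (p : ℕ).Prime := ⟨p.2⟩
  induction hn : Nat.card G using Nat.strong_induction_on generalizing G with
  | _ n ih =>
  subst hn
  have hquot : ∀ (K : Subgroup G) [K.Normal], K ≠ ⊥ →
      PrimeToClosed (p : ℕ) (𝔉.residual (G ⧸ K)) := by
    intro K _ hK
    have hDn : (D.map (QuotientGroup.mk' K)).Normal :=
      Subgroup.Normal.map ‹_› _ (QuotientGroup.mk'_surjective K)
    exact ih _ (card_quotient_lt hK) (D := D.map (QuotientGroup.mk' K))
      ((Subgroup.map_mono hD).trans (h𝔉.map_piNorm_le _ (QuotientGroup.mk'_surjective K)))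
      (h𝔉.primeToClosed_residual_quotient_map h) rfl
  -- A normal `p'`-subgroup can be factored out. In its absence `O_{π'}(G)` is trivial too, because
  -- `p ∈ π`, and the norm normalises the residuals themselves.
  by_cases hK : ∃ K : Subgroup G, K.Normal ∧ K ≠ ⊥ ∧ (Nat.card K).Coprime p
  · obtain ⟨K, hKn, hK1, hKp⟩ := hK
    exact h𝔉.primeToClosed_of_quotient hKp (hquot K hK1)
  push Not at hK
  by_cases hDbot : D = ⊥
  · exact h𝔉.primeToClosed_of_quotient (by rw [hDbot]; simp) h
  obtain ⟨L, hLD, hL⟩ := exists_isMinimalNormal_le ‹D.Normal› hDbot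
  have hLn := hL.normal
  obtain ⟨q, hq, hLq⟩ := hL.exists_isPGroup
  obtain rfl : q = p := by
    by_contra hqp
    exact hK L hLn hL.ne_bot (coprime_card_of_isPGroup_of_ne p.2 hq hLq hqp)
  by_cases hΦ : L ≤ frattini G
  · exact h𝔉.primeToClosed_of_le_frattini hΦ (hquot L hL.ne_bot)
  obtain ⟨M, hinf, hsup⟩ := hL.exists_isCompl hΦ
  have hO : piRadical πᶜ G = ⊥ := by
    by_contra hne
    refine hK _ piRadical_normal hne (Nat.Coprime.symm ((Nat.Prime.coprime_iff_not_dvd p.2).2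
      fun hd => piRadical_mem.2 p hd hp))
  -- `L` lies in the norm, so it normalises the residual of `M`; commutators of the two lie in `M ⊓
  -- L = ⊥`.
  have hcomm : ∀ r ∈ 𝔉.subgroupResidual M, ∀ l ∈ L, r * l = l * r := by
    intro r hr l hl
    have h1 := mem_piNorm_iff.1 (hD (hLD hl)) M
    rw [hO, sup_bot_eq] at h1
    have h2 : r * l * r⁻¹ * l⁻¹ ∈ M ⊓ L := by
      refine ⟨?_, L.mul_mem (hLn.conj_mem l hl r) (L.inv_mem hl)⟩
      have h3 := (Subgroup.mem_normalizer_iff.1 h1 r⁻¹).1 (inv_mem hr)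
      have h4 := subgroupResidual_le M (mul_mem hr h3)
      simpa [mul_assoc] using h4
    rw [hinf, Subgroup.mem_bot] at h2
    rwa [mul_inv_eq_one, mul_inv_eq_iff_eq_mul] at h2
  have hRn : (𝔉.subgroupResidual M).Normal := by
    rw [← Subgroup.normalizer_eq_top_iff, eq_top_iff, ← hsup, sup_le_iff]
    exact ⟨subgroup_le_normalizer_subgroupResidual M, fun l hl =>
      Subgroup.centralizer_le_normalizer _
        (Subgroup.mem_centralizer_iff.2 fun r hr => hcomm r hr l hl)⟩
  -- If `M ∈ 𝔉`, then `G ⧸ L` is an image of `M` and the residual of `G` lies in the `p`-group `L`.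
  -- Otherwise the residual of `M` and `L` are nontrivial normal subgroups with trivial
  -- intersection, and both quotients are covered by induction.
  by_cases hR : 𝔉.subgroupResidual M = ⊥
  · have hM : 𝔉.Mem M := by
      rw [h𝔉.mem_iff_residual_eq_bot]
      rwa [subgroupResidual, Subgroup.map_eq_bot_iff_of_injective _ M.subtype_injective] at hR
    have hsurj : Function.Surjective ((QuotientGroup.mk' L).comp M.subtype) := by
      rw [← MonoidHom.range_eq_top, MonoidHom.range_comp, Subgroup.range_subtype,
        ← Subgroup.map_top_of_surjective _ (QuotientGroup.mk'_surjective L), ← hsup,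
        Subgroup.map_sup, QuotientGroup.map_mk'_self, sup_bot_eq]
    have hle : 𝔉.residual G ≤ L := residual_le_of_mem (h𝔉.mem_of_surjective _ _ _ hsurj hM)
    exact PrimeToClosed.of_isPGroup (hLq.to_le hle)
  · have h1 := hquot _ hR
    have h2 := hquot L hL.ne_bot
    rw [← h𝔉.map_residual (QuotientGroup.mk' _) (QuotientGroup.mk'_surjective _)] at h1 h2
    refine h1.of_map_of_map h2 ?_
    rw [QuotientGroup.ker_mk', QuotientGroup.ker_mk', eq_bot_iff, ← hinf]
    exact inf_le_inf_right _ (subgroupResidual_le M)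

variable {G : Type u} [Group G]

/-- One step down the norm series, for the residual of a subgroup `W`: the norm of `G ⧸ D` restricts
into the norm of the image of `W`, where `primeToClosed_of_le_piNorm` applies. -/
theorem IsFormation.primeToClosed_map_piNormSeries (h𝔉 : 𝔉.IsFormation) {p : Nat.Primes}
    (hp : p ∈ π) [Finite G] [Group.IsSolvable G] (W : Subgroup G) {D E : Subgroup G} [D.Normal]
    [E.Normal] (hDE : ∀ x ∈ E, (x : G ⧸ D) ∈ piNorm 𝔉 πᶜ (G ⧸ D))
    (h : PrimeToClosed (p : ℕ) ((𝔉.subgroupResidual W).map (QuotientGroup.mk' E))) :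
    PrimeToClosed (p : ℕ) ((𝔉.subgroupResidual W).map (QuotientGroup.mk' D)) := by
  have hpf : Fact (p : ℕ).Prime := ⟨p.2⟩
  let W' : Subgroup (G ⧸ D) := W.map (QuotientGroup.mk' D)
  let f : W →* W' := (QuotientGroup.mk' D).subgroupMap W
  have hf : Function.Surjective f := (QuotientGroup.mk' D).subgroupMap_surjective W
  let N : Subgroup W' := (piNorm 𝔉 πᶜ (G ⧸ D)).comap W'.subtype
  have key : PrimeToClosed (p : ℕ) (𝔉.residual (W' ⧸ N)) := by
    rw [← h𝔉.map_residual ((QuotientGroup.mk' N).comp f)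
      ((QuotientGroup.mk'_surjective N).comp hf)]
    rw [subgroupResidual, Subgroup.map_map] at h
    refine h.map_of_ker_le fun x hx => ?_
    have hx' : (x : G) ∈ E := (QuotientGroup.eq_one_iff _).1 hx
    exact (QuotientGroup.eq_one_iff (f x)).2 (hDE x hx')
  have := (h𝔉.primeToClosed_of_le_piNorm hp (h𝔉.comap_piNorm_le W') key).map W'.subtype
  rw [← h𝔉.map_residual f hf, Subgroup.map_map] at this
  rw [subgroupResidual, Subgroup.map_map]
  exact this

theorem IsFormation.piNormInfty_le_intMaximal (h𝔉 : 𝔉.IsFormation) [Finite G] [Group.IsSolvable G] :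
    piNormInfty 𝔉 πᶜ G ≤ intMaximal (formationProduct (piNilpotent π) 𝔉) G := by
  refine le_sInf fun U hU => ?_
  replace hU : Maximal (fun V : Subgroup G => (formationProduct (piNilpotent π) 𝔉).Mem V) U := hU
  obtain ⟨n, hn⟩ := exists_piNormInfty_eq (𝔉 := 𝔉) (π := πᶜ) (G := G)
  have hU1 : (formationProduct (piNilpotent π) 𝔉).Mem U := hU.prop
  rw [mem_piNilpotent_product_subgroup_iff] at hU1
  -- By maximality of `U` it suffices that its join with the terminal norm remains in `𝔑_π ∘ 𝔉`.
  refine le_sup_right.trans (hU.le_of_ge (y := U ⊔ piNormInfty 𝔉 πᶜ G) ?_ le_sup_left)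
  rw [mem_piNilpotent_product_subgroup_iff]
  intro p hp
  have hpf : Fact (p : ℕ).Prime := ⟨p.2⟩
  rw [← hn n le_rfl]
  have key : ∀ i, PrimeToClosed (p : ℕ) ((𝔉.subgroupResidual (U ⊔ (piNormSeries 𝔉 πᶜ G n).1)).map
      (QuotientGroup.mk' (piNormSeries 𝔉 πᶜ G i).1)) →
      PrimeToClosed (p : ℕ) (𝔉.subgroupResidual (U ⊔ (piNormSeries 𝔉 πᶜ G n).1)) := by
    intro i
    induction i with
    | zero =>
      intro h
      refine h.of_map_of_ker ?_
      rw [QuotientGroup.ker_mk', piNormSeries]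
      simp
    | succ i ih =>
      exact fun h => ih (h𝔉.primeToClosed_map_piNormSeries hp _
        (fun x hx => mem_piNormSeries_succ_iff.1 hx) h)
  -- Modulo the terminal term, `U` and the join have the same image, hence the same residual.
  refine key n ?_
  rw [← h𝔉.subgroupResidual_map, Subgroup.map_sup, QuotientGroup.map_mk'_self, sup_bot_eq,
    h𝔉.subgroupResidual_map]
  exact (hU1 p hp).map _

end NormInMaximal

/-! ### The intersection of the maximal `𝔑_π ∘ 𝔉`-subgroups is hypercentral -/

section Intersection

/-- Conjugation permutes the `𝔛`-maximal subgroups. -/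
theorem intMaximal_normal {𝔛 : GroupClass.{u}} {G : Type u} [Group G] :
    (intMaximal 𝔛 G).Normal := by
  have hmem : ∀ (g : G) (U : Subgroup G), 𝔛.Mem U → 𝔛.Mem (U.map (MulAut.conj g).toMonoidHom) :=
    fun g U hU => 𝔛.mem_of_mulEquiv _ _
      (U.equivMapOfInjective (MulAut.conj g).toMonoidHom (MulAut.conj g).injective) hU
  have hinv : ∀ (g : G) (U : Subgroup G),
      (U.map (MulAut.conj g⁻¹).toMonoidHom).map (MulAut.conj g).toMonoidHom = U := by
    intro g U
    rw [Subgroup.map_map]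
    convert Subgroup.map_id U
    ext x
    simp [mul_assoc]
  refine ⟨fun x hx g => Subgroup.mem_sInf.2 fun U hU => ?_⟩
  replace hU : Maximal (fun V : Subgroup G => 𝔛.Mem V) U := hU
  have hmax : Maximal (fun V : Subgroup G => 𝔛.Mem V) (U.map (MulAut.conj g⁻¹).toMonoidHom) := by
    refine ⟨hmem _ _ hU.prop, fun V hV hle => ?_⟩
    have h1 := hU.le_of_ge (hmem g V hV) (by
      conv_lhs => rw [← hinv g U]
      exact Subgroup.map_mono hle)
    have h2 := Subgroup.map_mono (f := (MulAut.conj g⁻¹).toMonoidHom) h1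
    have h3 := hinv g⁻¹ V
    rw [inv_inv] at h3
    rwa [h3] at h2
  obtain ⟨u, hu, rfl⟩ := Subgroup.mem_sInf.1 hx _ hmax
  simpa [mul_assoc] using hu

variable {𝔉 : GroupClass.{u}} {π : Set Nat.Primes} {G : Type u} [Group G]

theorem isPGroup_map_mk_iff {p : ℕ} {R N : Subgroup G} [N.Normal] :
    IsPGroup p (R.map (QuotientGroup.mk' N)) ↔ ∀ x ∈ R, ∃ k : ℕ, x ^ p ^ k ∈ N := by
  rw [isPGroup_iff_pow_pow_eq_one]
  constructor
  · intro h x hx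
    obtain ⟨k, hk⟩ := h ⟨_, Subgroup.mem_map_of_mem (QuotientGroup.mk' N) hx⟩
    refine ⟨k, (QuotientGroup.eq_one_iff _).1 ?_⟩
    simpa [Subtype.ext_iff] using hk
  · rintro h ⟨_, x, hx, rfl⟩
    obtain ⟨k, hk⟩ := h x hx
    refine ⟨k, Subtype.ext ?_⟩
    simpa using (QuotientGroup.eq_one_iff _).2 hk

/-- A group that is minimal among the groups whose residual is not a `p`-group modulo the given
normal subgroup `N` belongs to `𝔑_π ∘ 𝔉`, as `G ⧸ N` is critical and `N` is contained in the
Frattini subgroup. -/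
theorem IsFormation.mem_product_of_critical_quotient (h𝔉 : 𝔉.IsFormation)
    (hb : BoundaryConditionIIISolvable 𝔉 π) {p : Nat.Primes} (hp : p ∈ π) [Finite G]
    [Group.IsSolvable G] {N : Subgroup G} [N.Normal]
    (hG : ¬ ∀ x ∈ 𝔉.residual G, ∃ k : ℕ, x ^ (p : ℕ) ^ k ∈ N)
    (hM : ∀ M : Subgroup G, M < ⊤ → ∀ x ∈ 𝔉.subgroupResidual M, ∃ k : ℕ, x ^ (p : ℕ) ^ k ∈ N) :
    (formationProduct (piNilpotent π) 𝔉).Mem G := by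
  have hres := h𝔉.map_residual (QuotientGroup.mk' N) (QuotientGroup.mk'_surjective N)
  have hcrit : IsSCritical (formationProduct (piGroups {p}) 𝔉) (G ⧸ N) := by
    refine ⟨inferInstance, ?_, fun B hB => ?_⟩
    · rwa [mem_pGroups_product_iff, ← hres, isPGroup_map_mk_iff]
    · rw [mem_pGroups_product_subgroup_iff,
        ← Subgroup.map_comap_eq_self_of_surjective (QuotientGroup.mk'_surjective N) B,
        h𝔉.subgroupResidual_map, isPGroup_map_mk_iff]
      refine hM _ (lt_top_iff_ne_top.2 fun h => hB.ne ?_)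
      rw [← Subgroup.map_comap_eq_self_of_surjective (QuotientGroup.mk'_surjective N) B, h,
        Subgroup.map_top_of_surjective _ (QuotientGroup.mk'_surjective N)]
  have hX := hb p hp (G ⧸ N) hcrit ⟨inferInstance, inferInstance⟩
  -- A maximal subgroup not containing `N` covers `G ⧸ N`, so its residual, a `p`-group modulo `N`,
  -- would cover the residual of `G ⧸ N`.
  have hΦ : N ≤ frattini G := by
    refine le_iInf₂ fun M hMc => ?_
    by_contra hNM
    have hsup : M ⊔ N = ⊤ := hMc.2 _ (left_lt_sup.2 hNM)
    refine hG fun x hx => ?_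
    have htop : M.map (QuotientGroup.mk' N) = ⊤ := by
      rw [← Subgroup.map_top_of_surjective _ (QuotientGroup.mk'_surjective N), ← hsup,
        Subgroup.map_sup, QuotientGroup.map_mk'_self, sup_bot_eq]
    have h1 := h𝔉.subgroupResidual_map (QuotientGroup.mk' N) M
    rw [htop, h𝔉.subgroupResidual_top, ← hres] at h1
    exact isPGroup_map_mk_iff.1 (h1 ▸ isPGroup_map_mk_iff.2 (hM M hMc.lt_top)) x hx
  rw [mem_piNilpotent_product_iff] at hX ⊢
  intro r hr
  have : Fact (r : ℕ).Prime := ⟨r.2⟩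
  exact h𝔉.primeToClosed_of_le_frattini hΦ (hX r hr)

/-- A normal subgroup that induces a `p`-group of automorphisms on a chief factor of order divisible
by `p` centralises it. -/
theorem IsChiefFactor.le_ker_of_pow_mem {K L R : Subgroup G} [K.Normal] [L.Normal] [hR : R.Normal]
    [Finite G] {p : ℕ} [Fact p.Prime] (h : IsChiefFactor K L) (hpd : p ∣ Nat.card (factor K L))
    (hp : ∀ x ∈ R, ∃ k : ℕ, x ^ p ^ k ∈ (factorAction K L).ker) :
    R ≤ (factorAction K L).ker := by
  have hP : IsPGroup p (R.map (factorAction K L)) := by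
    rw [isPGroup_iff_pow_pow_eq_one]
    rintro ⟨_, x, hx, rfl⟩
    obtain ⟨k, hk⟩ := hp x hx
    exact ⟨k, Subtype.ext (by simpa using hk)⟩
  -- The number of fixed points of a `p`-group is divisible by `p` here, so the fixed point `1` is
  -- not the only one. As `R` is normal, its fixed points form a normal subgroup, necessarily the
  -- whole chief factor.
  obtain ⟨b, hb, hb1⟩ := hP.exists_fixed_point_of_prime_dvd_card_of_fixed_point (factor K L) hpd
    (a := 1) (fun g => map_one g.1)
  let F : Subgroup (G ⧸ K) :=
    { carrier := {v | v ∈ factor K L ∧ ∀ r ∈ R, (r : G ⧸ K) * v * (r : G ⧸ K)⁻¹ = v}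
      one_mem' := ⟨one_mem _, fun r _ => by simp⟩
      mul_mem' := fun {v w} hv hw => ⟨mul_mem hv.1 hw.1, fun r hr => by
        rw [← conj_mul, hv.2 r hr, hw.2 r hr]⟩
      inv_mem' := fun {v} hv => ⟨inv_mem hv.1, fun r hr => by rw [← conj_inv, hv.2 r hr]⟩ }
  have hF : F.Normal := by
    refine ⟨fun v hv g => ⟨(factor_normal).conj_mem v hv.1 g, fun r hr => ?_⟩⟩
    obtain ⟨g, rfl⟩ := QuotientGroup.mk_surjective g
    have h1 := hv.2 (g⁻¹ * r * g) (by simpa using hR.conj_mem r hr g⁻¹)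
    simp only [QuotientGroup.mk_mul, QuotientGroup.mk_inv] at h1
    conv_rhs => rw [← h1]
    group
  have hFb : (b : G ⧸ K) ∈ F := ⟨b.2, fun r hr =>
    congrArg Subtype.val (hb ⟨_, Subgroup.mem_map_of_mem (factorAction K L) hr⟩)⟩
  have hFe : F = factor K L := (h.isMinimalNormal.eq_bot_or_eq hF fun v hv => hv.1).resolve_left
    fun he => hb1 (by
      rw [he, Subgroup.mem_bot] at hFb
      exact Subtype.ext hFb.symm)
  intro r hr
  rw [MonoidHom.mem_ker]
  ext v
  exact (show (v : G ⧸ K) ∈ F from hFe.ge v.2).2 r hr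

theorem IsFormation.isPiHypercentral_intMaximal (h𝔉 : 𝔉.IsFormation) (hS : 𝔉.IsSubgroupClosed)
    (hb : BoundaryConditionIIISolvable 𝔉 π) [Finite G] [Group.IsSolvable G] :
    IsPiHypercentral (formationProduct nilpotent 𝔉) π
      (intMaximal (formationProduct (piNilpotent π) 𝔉) G) := by
  refine ⟨intMaximal_normal, ?_⟩
  rintro K L _ hLn hKL hLI ⟨p, hp, hpd⟩
  have hpf : Fact (p : ℕ).Prime := ⟨p.2⟩
  rw [h𝔉.isCentralFactor_iff hKL]
  by_contra hnot
  have htop : ¬ ∀ x ∈ 𝔉.subgroupResidual (⊤ : Subgroup G), ∃ k : ℕ,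
      x ^ (p : ℕ) ^ k ∈ (factorAction K L).ker := fun h => hnot (by
    rw [h𝔉.subgroupResidual_top] at h
    exact hKL.le_ker_of_pow_mem hpd h)
  -- Minimality of `H` makes its quotient by `H ∩ C_G(L / K)` critical, which is what the boundary
  -- condition needs.
  obtain ⟨H, hH⟩ := (Set.toFinite {H : Subgroup G | ¬ ∀ x ∈ 𝔉.subgroupResidual H, ∃ k : ℕ,
      x ^ (p : ℕ) ^ k ∈ (factorAction K L).ker}).exists_minimal ⟨⊤, htop⟩
  have hHX : (formationProduct (piNilpotent π) 𝔉).Mem H := by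
    refine h𝔉.mem_product_of_critical_quotient hb hp
      (N := (factorAction K L).ker.comap H.subtype) (fun h => hH.prop ?_) ?_
    · rintro _ ⟨x, hx, rfl⟩
      obtain ⟨k, hk⟩ := h x hx
      exact ⟨k, by simpa only [Subgroup.mem_comap, map_pow, Subgroup.coe_subtype] using hk⟩
    · intro M hM x hx
      have hlt : ¬ H ≤ M.map H.subtype := fun hle => hM.ne (top_le_iff.1 fun y _ => by
        obtain ⟨m, hm, hmy⟩ := hle y.2
        rwa [← show m = y from Subtype.ext hmy])
      by_contra hc
      refine hlt (hH.le_of_le (y := M.map H.subtype) (fun h => hc ?_) (Subgroup.map_subtype_le _))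
      rw [h𝔉.subgroupResidual_map] at h
      obtain ⟨k, hk⟩ := h x (Subgroup.mem_map_of_mem _ hx)
      exact ⟨k, by simpa only [Subgroup.mem_comap, map_pow, Subgroup.coe_subtype] using hk⟩
  obtain ⟨U, hHU, hU⟩ := (Set.toFinite {V : Subgroup G |
    (formationProduct (piNilpotent π) 𝔉).Mem V}).exists_le_maximal hHX
  have hLU : L ≤ U := hLI.trans (sInf_le hU)
  have hUX : (formationProduct (piNilpotent π) 𝔉).Mem U := hU.prop
  rw [mem_piNilpotent_product_subgroup_iff] at hUX
  obtain ⟨q, hq, hLq⟩ := hKL.isMinimalNormal.exists_isPGroup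
  obtain rfl : q = p := by
    by_contra hqp
    exact (Nat.Prime.coprime_iff_not_dvd p.2).1
      (coprime_card_of_isPGroup_of_ne p.2 hq hLq hqp).symm hpd
  -- Let `y` be a `p'`-power of `x` and `l ∈ L`, so `l ∈ U`. The commutator `y * (l * y⁻¹ * l⁻¹)` is
  -- a product of two `p'`-elements of the residual of `U`, hence a `p'`-element; but it lies in
  -- `L`, a `p`-group modulo `K`. So `y` centralises `L / K`, against the choice of `H`.
  refine hH.prop fun x hx => ?_
  obtain ⟨a, ha⟩ := exists_coprime_orderOf_pow (p := p) x
  refine ⟨a, mem_ker_factorAction_iff.2 fun l hl => ?_⟩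
  have hy := h𝔉.subgroupResidual_mono hS hHU (pow_mem hx ((p : ℕ) ^ a))
  generalize x ^ (p : ℕ) ^ a = y at ha hy
  have h1 : l * y⁻¹ * l⁻¹ ∈ 𝔉.subgroupResidual U := (Subgroup.mem_normalizer_iff.1
    (subgroup_le_normalizer_subgroupResidual U (hLU hl)) y⁻¹).1 (inv_mem hy)
  have h2 := hUX p hp y hy _ h1 ha (coprime_orderOf_conj.2 (by rwa [orderOf_inv]))
  rw [show y * (l * y⁻¹ * l⁻¹) = y * l * y⁻¹ * l⁻¹ by simp [mul_assoc]] at h2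
  rw [← QuotientGroup.eq_one_iff]
  refine eq_one_of_isPGroup_of_coprime hLq ?_ (coprime_orderOf_map (QuotientGroup.mk' K) h2)
  exact Subgroup.mem_map_of_mem (QuotientGroup.mk' K)
    (mul_mem (hLn.conj_mem l hl y) (inv_mem hl))

end Intersection

/-! ### Faithful irreducible modules -/

section Irreducible

/-- The action by automorphisms on an invariant subgroup. -/
def restrictAut {G M : Type*} [Group G] [Group M] (ψ : G →* MulAut M) (W : Subgroup M)
    (hW : ∀ g, ∀ w ∈ W, ψ g w ∈ W) : G →* MulAut W where
  toFun g :=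
    { toFun := fun w => ⟨ψ g w, hW g w w.2⟩
      invFun := fun w => ⟨ψ g⁻¹ w, hW g⁻¹ w w.2⟩
      left_inv := fun w => Subtype.ext (by simp)
      right_inv := fun w => Subtype.ext (by simp)
      map_mul' := fun v w => Subtype.ext (by simp) }
  map_one' := by ext; simp
  map_mul' g h := by ext; simp

/-- The action `ψ` of `G` on `V` leaves no proper nontrivial subgroup invariant. -/
def IsIrreducibleAction {G V : Type*} [Group G] [Group V] (ψ : G →* MulAut V) : Prop :=
  ∀ W : Subgroup V, (∀ g, ∀ w ∈ W, ψ g w ∈ W) → W = ⊥ ∨ W = ⊤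

/-- In the regular module over `ZMod p`, the kernel of the trace over `L` is a nonzero submodule. A
vector of it fixed by `L` is killed by the order of `L`, which is prime to `p`, so it vanishes; any
minimal submodule of the kernel will do. -/
theorem exists_irreducibleAction {G : Type u} [Group G] [Finite G] {p : ℕ} [hp : Fact p.Prime]
    {L : Subgroup G} [L.Normal] (hL : L ≠ ⊥) (hLp : (Nat.card L).Coprime p) :
    ∃ (V : Type u) (_ : CommGroup V) (ψ : G →* MulAut V), Finite V ∧ IsPGroup p V ∧
      Nontrivial V ∧ IsIrreducibleAction ψ ∧ ¬ L ≤ ψ.ker := by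
  classical
  have : Fintype L := Fintype.ofFinite L
  let M := G → Multiplicative (ZMod p)
  have hMp : ∀ f : M, f ^ p = 1 := fun f => by
    ext x
    change (p : ℕ) • (Multiplicative.toAdd (f x)) = 0
    simp
  have : Finite M := inferInstance
  let ψ : G →* MulAut M := mulAutArrow
  have hψ : ∀ g (f : M) x, ψ g f x = f (g⁻¹ * x) := fun g f x => rfl
  let e : M → M := fun f => ∏ l : L, ψ l f
  have he_mul : ∀ f f', e (f * f') = e f * e f' := fun f f' => by
    simp only [e, map_mul, Finset.prod_mul_distrib]
  have he_inv : ∀ f, e f⁻¹ = (e f)⁻¹ := fun f =>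
    eq_inv_of_mul_eq_one_left (by rw [← he_mul, inv_mul_cancel]; simp [e])
  have he_conj : ∀ g f, e (ψ g f) = ψ g (e f) := fun g f => by
    simp only [e, map_prod]
    refine Fintype.prod_equiv (MulAut.conjNormal g⁻¹ : MulAut L).toEquiv _ _ fun l => ?_
    rw [← MulAut.mul_apply, ← MulAut.mul_apply, ← map_mul, ← map_mul]
    congr 2
    simp [mul_assoc]
  have he_left : ∀ (l : L) f, e (ψ l f) = e f := fun l f => by
    simp only [e]
    refine Fintype.prod_equiv (Equiv.mulRight l) _ _ fun l' => ?_
    rw [← MulAut.mul_apply, ← map_mul]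
    rfl
  let W₀ : Subgroup M :=
    { carrier := {f | e f = 1}
      one_mem' := by simp [e]
      mul_mem' := fun {f f'} hf hf' => by
        change e (f * f') = 1
        rw [he_mul, show e f = 1 from hf, show e f' = 1 from hf', one_mul]
      inv_mem' := fun {f} hf => by
        change e f⁻¹ = 1
        rw [he_inv, show e f = 1 from hf, inv_one] }
  have hW₀ : ∀ g, ∀ w ∈ W₀, ψ g w ∈ W₀ := fun g w hw => by
    change e (ψ g w) = 1
    rw [he_conj, show e w = 1 from hw, map_one]
  have hW₀1 : W₀ ≠ ⊥ := by
    obtain ⟨l, hl1⟩ := (Subgroup.ne_bot_iff_exists_ne_one.1 hL)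
    intro hb
    -- The basis vector at `1` and its translate by `l ≠ 1` have the same trace and differ, so their
    -- quotient is a nontrivial kernel element.
    let δ : M := Pi.mulSingle 1 (Multiplicative.ofAdd 1)
    have h1 : δ * (ψ l δ)⁻¹ ∈ W₀ := by
      change e _ = 1
      rw [he_mul, he_inv, he_left, mul_inv_cancel]
    rw [hb, Subgroup.mem_bot] at h1
    have h2 := congrFun h1 1
    have hl2 : ((l : G))⁻¹ * 1 ≠ 1 := by
      simpa using hl1
    rw [Pi.mul_apply, Pi.inv_apply, hψ] at h2
    simp only [δ, Pi.mulSingle_eq_same, Pi.mulSingle_eq_of_ne hl2] at h2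
    rw [inv_one, mul_one] at h2
    exact one_ne_zero (Multiplicative.ofAdd.injective h2 : (1 : ZMod p) = 0)
  obtain ⟨W, hWle, hW⟩ := (Set.toFinite {W : Subgroup M |
    (∀ g, ∀ w ∈ W, ψ g w ∈ W) ∧ W ≠ ⊥}).exists_le_minimal ⟨hW₀, hW₀1⟩
  obtain ⟨hWinv, hW1⟩ := hW.prop
  refine ⟨W, inferInstance, restrictAut ψ W hWinv, inferInstance, ?_, ?_, ?_, ?_⟩
  · exact isPGroup_iff_pow_pow_eq_one.2 fun w => ⟨1, Subtype.ext (by simpa using hMp w)⟩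
  · exact W.nontrivial_iff_ne_bot.2 hW1
  · intro A hA
    by_cases hA1 : A = ⊥
    · exact .inl hA1
    right
    have h1 := hW.le_of_le (y := A.map W.subtype) ⟨?_, fun h => hA1
      ((Subgroup.map_eq_bot_iff_of_injective _ W.subtype_injective).1 h)⟩
      (Subgroup.map_subtype_le A)
    · refine top_le_iff.1 fun w _ => ?_
      obtain ⟨a, ha, haw⟩ := h1 w.2
      rwa [← show a = w from Subtype.ext haw]
    · rintro g _ ⟨a, ha, rfl⟩
      exact ⟨_, hA g a ha, rfl⟩
  · intro hle
    refine hW1 ((Subgroup.eq_bot_iff_forall _).2 fun w hw => ?_)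
    have h1 : ∀ l : L, ψ l w = w := fun l => by
      have h3 := DFunLike.congr_fun (MonoidHom.mem_ker.1 (hle l.2)) (⟨w, hw⟩ : W)
      exact congrArg Subtype.val h3
    have h2 : w ^ Nat.card L = 1 := by
      have h3 : e w = 1 := hWle hw
      simpa [e, h1] using h3
    exact orderOf_eq_one_iff.1 (Nat.eq_one_of_dvd_coprimes hLp (orderOf_dvd_of_pow_eq_one h2)
      (orderOf_dvd_of_pow_eq_one (hMp w)))

end Irreducible

/-! ### Critical groups outside `𝔑_π ∘ 𝔉` -/

section Critical

variable {𝔉 : GroupClass.{u}} {π : Set Nat.Primes} {G : Type u} [Group G]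

theorem primeToClosed_of_isPGroup {G : Type*} [Group G] [Finite G] {p r : ℕ} [Fact p.Prime]
    [Fact r.Prime] {R : Subgroup G} (h : IsPGroup p R) : PrimeToClosed r R := by
  have := h.isNilpotent
  exact primeToClosed_of_isNilpotent R

theorem mem_product_of_pGroups_product [Finite G] {p : Nat.Primes}
    (h : (formationProduct (piGroups {p}) 𝔉).Mem G) :
    (formationProduct (piNilpotent π) 𝔉).Mem G := by
  have hpf : Fact (p : ℕ).Prime := ⟨p.2⟩
  rw [mem_pGroups_product_iff] at h
  rw [mem_piNilpotent_product_iff]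
  intro r _
  have hrf : Fact (r : ℕ).Prime := ⟨r.2⟩
  exact primeToClosed_of_isPGroup h

/-- If the boundary condition fails, then it fails for a group with a faithful irreducible
representation in characteristic `p`. -/
theorem IsFormation.exists_faithful_irreducible (h𝔉 : 𝔉.IsFormation) {p : Nat.Primes} [Finite G]
    [Group.IsSolvable G] (hcrit : IsSCritical (formationProduct (piGroups {p}) 𝔉) G)
    (hX : ¬ (formationProduct (piNilpotent π) 𝔉).Mem G) :
    ∃ (H : Type u) (_ : Group H) (V : Type u) (_ : CommGroup V) (ψ : H →* MulAut V),
      Group.IsSolvable H ∧ IsSCritical (formationProduct (piGroups {p}) 𝔉) H ∧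
      ¬ (formationProduct (piNilpotent π) 𝔉).Mem H ∧ Finite V ∧ IsPGroup (p : ℕ) V ∧
      Nontrivial V ∧ IsIrreducibleAction ψ ∧ Function.Injective ψ := by
  have hpf : Fact (p : ℕ).Prime := ⟨p.2⟩
  induction hn : Nat.card G using Nat.strong_induction_on generalizing G with
  | _ n ih =>
  subst hn
  -- A quotient outside `𝔑_π ∘ 𝔉` is outside `𝔊_p ∘ 𝔉` as well, hence again critical. So all proper
  -- quotients may be assumed to lie in `𝔑_π ∘ 𝔉`.
  by_cases hK : ∃ (K : Subgroup G) (_ : K.Normal), K ≠ ⊥ ∧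
      ¬ (formationProduct (piNilpotent π) 𝔉).Mem (G ⧸ K)
  · obtain ⟨K, hKn, hK1, hKX⟩ := hK
    refine ih _ (card_quotient_lt hK1) ⟨inferInstance, fun h => hKX
      (mem_product_of_pGroups_product h), fun B hB => ?_⟩ hKX rfl
    have hlt : B.comap (QuotientGroup.mk' K) < ⊤ := lt_top_iff_ne_top.2 fun h => hB.ne (by
      rw [← Subgroup.map_comap_eq_self_of_surjective (QuotientGroup.mk'_surjective K) B, h,
        Subgroup.map_top_of_surjective _ (QuotientGroup.mk'_surjective K)])
    have h1 := hcrit.2.2 _ hlt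
    rw [mem_pGroups_product_subgroup_iff] at h1 ⊢
    rw [← Subgroup.map_comap_eq_self_of_surjective (QuotientGroup.mk'_surjective K) B,
      h𝔉.subgroupResidual_map]
    exact h1.map _
  push Not at hK
  have hnp : ¬ IsPGroup (p : ℕ) (𝔉.residual G) := fun h =>
    hcrit.2.1 (mem_pGroups_product_iff.2 h)
  obtain ⟨r, hr, hrR⟩ : ∃ r ∈ π, ¬ PrimeToClosed (r : ℕ) (𝔉.residual G) := by
    rw [mem_piNilpotent_product_iff] at hX
    push Not at hX
    exact hX
  have hrf : Fact (r : ℕ).Prime := ⟨r.2⟩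
  have hquot : ∀ (K : Subgroup G) [K.Normal], K ≠ ⊥ →
      PrimeToClosed (r : ℕ) (𝔉.residual (G ⧸ K)) := fun K hKn hK1 =>
    mem_piNilpotent_product_iff.1 (hK K hKn hK1) r hr
  -- If `L` were an `r'`-group or a Frattini subgroup, `r`-nilpotency of the residual would lift
  -- from `G ⧸ L`. So `L` is an `r`-group with a proper complement, which is in `𝔊_p ∘ 𝔉` and covers
  -- `G ⧸ L`.
  have hmin : ∀ L : Subgroup G, IsMinimalNormal L → IsPGroup (r : ℕ) L ∧
      ∀ x ∈ 𝔉.residual G, ∃ k : ℕ, x ^ (p : ℕ) ^ k ∈ L := by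
    intro L hL
    have hLn := hL.normal
    obtain ⟨q, hq, hLq⟩ := hL.exists_isPGroup
    have hqr : q = r := by
      by_contra hqr
      exact hrR (h𝔉.primeToClosed_of_quotient (coprime_card_of_isPGroup_of_ne r.2 hq hLq hqr)
        (hquot L hL.ne_bot))
    refine ⟨hqr ▸ hLq, ?_⟩
    have hΦ : ¬ L ≤ frattini G := fun hΦ =>
      hrR (h𝔉.primeToClosed_of_le_frattini hΦ (hquot L hL.ne_bot))
    obtain ⟨M, hinf, hsup⟩ := hL.exists_isCompl hΦ
    have hM : M < ⊤ := lt_top_iff_ne_top.2 fun h => hL.ne_bot (by rwa [h, top_inf_eq] at hinf)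
    have hMp := (mem_pGroups_product_subgroup_iff.1 (hcrit.2.2 M hM)).map (QuotientGroup.mk' L)
    have htop : M.map (QuotientGroup.mk' L) = ⊤ := by
      rw [← Subgroup.map_top_of_surjective _ (QuotientGroup.mk'_surjective L), ← hsup,
        Subgroup.map_sup, QuotientGroup.map_mk'_self, sup_bot_eq]
    rw [← h𝔉.subgroupResidual_map, htop, h𝔉.subgroupResidual_top,
      ← h𝔉.map_residual _ (QuotientGroup.mk'_surjective L), isPGroup_map_mk_iff] at hMp
    exact hMp
  have hRne : 𝔉.residual G ≠ ⊥ := fun h => hnp (by rw [h]; exact IsPGroup.of_bot)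
  obtain ⟨L, -, hL⟩ := exists_isMinimalNormal_le residual_normal hRne
  have hLn := hL.normal
  obtain ⟨hLr, hLR⟩ := hmin L hL
  have hrp : (r : ℕ) ≠ p := by
    intro hrp
    refine hnp (isPGroup_iff_pow_pow_eq_one.2 fun x => ?_)
    obtain ⟨a, ha⟩ := hLR x x.2
    obtain ⟨b, hb⟩ := isPGroup_iff_pow_pow_eq_one.1 hLr ⟨_, ha⟩
    rw [hrp, Subtype.ext_iff] at hb
    refine ⟨a + b, Subtype.ext ?_⟩
    simpa [pow_add, pow_mul] using hb
  obtain ⟨V, _, ψ, hVf, hVp, hVn, hψ, hLψ⟩ := exists_irreducibleAction hL.ne_bot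
    (coprime_card_of_isPGroup_of_ne p.2 r.2 hLr hrp)
  refine ⟨G, inferInstance, V, inferInstance, ψ, inferInstance, hcrit, hX, hVf, hVp, hVn, hψ, ?_⟩
  rw [← MonoidHom.ker_eq_bot_iff]
  by_contra hker
  obtain ⟨L', hL'le, hL'⟩ := exists_isMinimalNormal_le inferInstance hker
  obtain ⟨-, hL'R⟩ := hmin L' hL'
  -- If the two meet trivially, the residual of `G`, a `p`-group modulo each, is a `p`-group.
  -- Otherwise `L` lies in the kernel of `ψ`, against the choice of `ψ`.
  rcases hL.inf_eq_bot_or_le hL'.normal with h | h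
  · refine hnp (isPGroup_iff_pow_pow_eq_one.2 fun x => ?_)
    obtain ⟨a, ha⟩ := hLR x x.2
    obtain ⟨b, hb⟩ := hL'R x x.2
    refine ⟨a + b, Subtype.ext ?_⟩
    have h1 : (x : G) ^ (p : ℕ) ^ (a + b) ∈ L' ⊓ L := by
      constructor
      · rw [pow_add, mul_comm, pow_mul]
        exact pow_mem hb _
      · rw [pow_add, pow_mul]
        exact pow_mem ha _
    rw [h, Subgroup.mem_bot] at h1
    simpa using h1
  · exact hLψ (h.trans hL'le)

end Critical

/-! ### The semidirect product with a faithful irreducible module -/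

section Semidirect

open SemidirectProduct

variable {𝔉 : GroupClass.{u}} {π : Set Nat.Primes} {G V : Type u} [Group G] [CommGroup V]
  {ψ : G →* MulAut V}

theorem range_inl_normal : (inl : V →* V ⋊[ψ] G).range.Normal := by
  rw [range_inl_eq_ker_rightHom]
  infer_instance

theorem IsIrreducibleAction.isMinimalNormal_range_inl [Nontrivial V] (hψ : IsIrreducibleAction ψ) :
    IsMinimalNormal (inl : V →* V ⋊[ψ] G).range := by
  refine ⟨⟨range_inl_normal, fun hb => ?_⟩, ?_⟩
  · obtain ⟨v, hv⟩ := exists_ne (1 : V)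
    have h1 : (inl v : V ⋊[ψ] G) ∈ (inl : V →* V ⋊[ψ] G).range := ⟨v, rfl⟩
    rw [hb, Subgroup.mem_bot, ← map_one inl, inl_inj] at h1
    exact hv h1
  · rintro N ⟨hN, hN1⟩ hle
    rcases hψ (N.comap inl) (fun g w hw => by
      have := hN.conj_mem _ hw (inr g)
      rw [← map_inv, ← inl_aut] at this
      exact this) with h | h
    · refine absurd ((Subgroup.eq_bot_iff_forall _).2 fun x hx => ?_) hN1
      obtain ⟨v, rfl⟩ := hle hx
      have hv : v ∈ N.comap inl := hx
      rw [h, Subgroup.mem_bot] at hv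
      rw [hv, map_one]
    · rintro _ ⟨v, rfl⟩
      exact (show v ∈ N.comap inl by rw [h]; trivial)

/-- `V` is abelian, so `x` acts on it by conjugation exactly as `ψ x.right`, and `ψ` is faithful. -/
theorem right_eq_one_of_commute (hinj : Function.Injective ψ) {x : V ⋊[ψ] G}
    (h : ∀ v : V, x * inl v = inl v * x) : x.right = 1 := by
  refine (injective_iff_map_eq_one ψ).1 hinj _ ?_
  ext1 v
  have h1 := congrArg left (h v)
  simp only [mul_left, left_inl, right_inl, map_one, MulAut.one_apply] at h1
  rw [mul_comm] at h1
  exact mul_right_cancel h1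

/-- A normal subgroup meeting `V` trivially centralises `V`; by faithfulness it lies in `V`, so it
is trivial. -/
theorem IsIrreducibleAction.range_inl_le [Nontrivial V] (hψ : IsIrreducibleAction ψ)
    (hinj : Function.Injective ψ) {N : Subgroup (V ⋊[ψ] G)} (hN : N.Normal) (hN1 : N ≠ ⊥) :
    (inl : V →* V ⋊[ψ] G).range ≤ N := by
  refine (hψ.isMinimalNormal_range_inl.inf_eq_bot_or_le hN).resolve_left fun h => hN1 ?_
  rw [← inf_eq_left.2 (show N ≤ (inl : V →* V ⋊[ψ] G).range from fun x hx => ?_), h]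
  rw [range_inl_eq_ker_rightHom]
  exact right_eq_one_of_commute hinj fun v =>
    commute_of_inf_eq_bot hN range_inl_normal h hx ⟨v, rfl⟩

theorem finite_semidirectProduct [Finite V] [Finite G] : Finite (V ⋊[ψ] G) :=
  Finite.of_equiv _ equivProd.symm

/-- A `p`-group on which a critical group outside `𝔑_π ∘ 𝔉` acts is contained in every maximal
`𝔑_π ∘ 𝔉`-subgroup of the semidirect product. -/
theorem IsFormation.range_inl_le_intMaximal (h𝔉 : 𝔉.IsFormation) [Finite V] [Finite G]
    {p : Nat.Primes} (hVp : IsPGroup (p : ℕ) V)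
    (hcrit : IsSCritical (formationProduct (piGroups {p}) 𝔉) G)
    (hX : ¬ (formationProduct (piNilpotent π) 𝔉).Mem G) :
    (inl : V →* V ⋊[ψ] G).range ≤
      intMaximal (formationProduct (piNilpotent π) 𝔉) (V ⋊[ψ] G) := by
  have := finite_semidirectProduct (ψ := ψ)
  have hpf : Fact (p : ℕ).Prime := ⟨p.2⟩
  refine le_sInf fun U hU => ?_
  replace hU : Maximal (fun W : Subgroup (V ⋊[ψ] G) =>
    (formationProduct (piNilpotent π) 𝔉).Mem W) U := hU
  have hUX := hU.prop
  refine le_sup_right.trans (hU.le_of_ge (y := U ⊔ (inl : V →* V ⋊[ψ] G).range) ?_ le_sup_left)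
  -- `U` cannot project onto `G`, as `G` would inherit membership in `𝔑_π ∘ 𝔉`. So criticality
  -- applies to its image, and the residual of the join of `U` with `V` is a `p`-group extended by a
  -- `p`-group.
  have hlt : U.map rightHom < ⊤ := lt_top_iff_ne_top.2 fun h => hX (by
    rw [mem_piNilpotent_product_subgroup_iff] at hUX
    rw [mem_piNilpotent_product_iff, ← h𝔉.subgroupResidual_top, ← h, h𝔉.subgroupResidual_map]
    intro r hr
    have hrf : Fact (r : ℕ).Prime := ⟨r.2⟩
    exact (hUX r hr).map _)
  have h1 := mem_pGroups_product_subgroup_iff.1 (hcrit.2.2 _ hlt)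
  have h2 : (U ⊔ (inl : V →* V ⋊[ψ] G).range).map rightHom = U.map rightHom := by
    rw [Subgroup.map_sup, range_inl_eq_ker_rightHom, (Subgroup.map_eq_bot_iff _).2 le_rfl,
      sup_bot_eq]
  rw [← h2, h𝔉.subgroupResidual_map] at h1
  refine mem_product_of_pGroups_product (p := p) (mem_pGroups_product_subgroup_iff.2 ?_)
  refine (h1.comap_of_ker_isPGroup rightHom ?_).to_le (Subgroup.le_comap_map _ _)
  rw [← range_inl_eq_ker_rightHom]
  exact hVp.of_surjective _ inl.rangeRestrict_surjective

/-- Some nontrivial hypercentral subgroup would contain `V`, so the residual of the semidirect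
product would centralise `V`; it contains the residual of `G`, which acts faithfully. -/
theorem IsFormation.range_inl_not_le_piHypercentre (h𝔉 : 𝔉.IsFormation) (hS : 𝔉.IsSubgroupClosed)
    [Finite V] [Finite G] [Group.IsSolvable (V ⋊[ψ] G)] [Nontrivial V] {p : Nat.Primes}
    (hp : p ∈ π) (hVp : IsPGroup (p : ℕ) V) (hψ : IsIrreducibleAction ψ)
    (hinj : Function.Injective ψ) (hR : 𝔉.residual G ≠ ⊥) :
    ¬ (inl : V →* V ⋊[ψ] G).range ≤
      piHypercentre (formationProduct nilpotent 𝔉) π (V ⋊[ψ] G) := by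
  have := finite_semidirectProduct (ψ := ψ)
  have hpf : Fact (p : ℕ).Prime := ⟨p.2⟩
  have hmin := hψ.isMinimalNormal_range_inl
  have hVn := range_inl_normal (ψ := ψ)
  intro hle
  obtain ⟨N, hN, hN1⟩ : ∃ N : Subgroup (V ⋊[ψ] G),
      IsPiHypercentral (formationProduct nilpotent 𝔉) π N ∧ N ≠ ⊥ := by
    by_contra! hc
    exact hmin.ne_bot (le_bot_iff.1 (hle.trans (sSup_le fun N hN => (hc N hN).le)))
  have hVN := hψ.range_inl_le hinj hN.normal hN1
  have hchief : IsChiefFactor ⊥ (inl : V →* V ⋊[ψ] G).range :=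
    ⟨inferInstance, hVn, bot_lt_iff_ne_bot.2 hmin.ne_bot,
      fun M hM _ hMV => hmin.eq_bot_or_eq hM hMV⟩
  have hcard : (p : ℕ) ∣ Nat.card (factor ⊥ (inl : V →* V ⋊[ψ] G).range) := by
    have h1 : IsPGroup (p : ℕ) (factor ⊥ (inl : V →* V ⋊[ψ] G).range) :=
      (hVp.of_surjective _ inl.rangeRestrict_surjective).map _
    refine h1.card_eq_or_dvd.resolve_left fun h => hchief.isMinimalNormal.ne_bot ?_
    exact Subgroup.card_eq_one.1 h
  have hcen := (h𝔉.isCentralFactor_iff hchief).1 (hN.central _ _ hchief hVN ⟨p, hp, hcard⟩)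
  refine hR ((Subgroup.eq_bot_iff_forall _).2 fun r hr => ?_)
  have hr' : (inr r : V ⋊[ψ] G) ∈ 𝔉.residual (V ⋊[ψ] G) :=
    h𝔉.map_residual_le hS inr (Subgroup.mem_map_of_mem _ hr)
  refine right_eq_one_of_commute hinj (x := inr r) fun v => ?_
  have h1 := mem_ker_factorAction_iff.1 (hcen hr') (inl v) ⟨v, rfl⟩
  rwa [Subgroup.mem_bot, mul_inv_eq_one, mul_inv_eq_iff_eq_mul] at h1

theorem IsFormation.piNormSeries_eq_bot (h𝔉 : 𝔉.IsFormation) [Finite G] (h : piNorm 𝔉 π G = ⊥)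
    (i : ℕ) : (piNormSeries 𝔉 π G i).1 = ⊥ := by
  have key : ∀ (D : Subgroup G) [D.Normal], D = ⊥ →
      (piNorm 𝔉 π (G ⧸ D)).comap (QuotientGroup.mk' D) = ⊥ := by
    rintro D _ rfl
    have h1 := h𝔉.map_piNorm_le (π := π) (QuotientGroup.quotientBot (G := G)).toMonoidHom
      (QuotientGroup.quotientBot (G := G)).surjective
    rw [h] at h1
    refine (Subgroup.eq_bot_iff_forall _).2 fun x hx => ?_
    exact h1 ⟨(x : G ⧸ (⊥ : Subgroup G)), hx, rfl⟩
  induction i with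
  | zero => rfl
  | succ i ih => exact key _ ih

/-- The norm would be nontrivial and contain `V`, while `O_{π'}` is trivial since it cannot contain
the `p`-group `V`. So `V` would normalise the residual of the complement `G`, and hence commute with
it. -/
theorem IsFormation.range_inl_not_le_piNormInfty (h𝔉 : 𝔉.IsFormation)
    [Finite V] [Finite G] [Nontrivial V] {p : Nat.Primes}
    (hp : p ∈ π) (hVp : IsPGroup (p : ℕ) V) (hψ : IsIrreducibleAction ψ)
    (hinj : Function.Injective ψ) (hR : 𝔉.residual G ≠ ⊥) :
    ¬ (inl : V →* V ⋊[ψ] G).range ≤ piNormInfty 𝔉 πᶜ (V ⋊[ψ] G) := by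
  have := finite_semidirectProduct (ψ := ψ)
  have hpf : Fact (p : ℕ).Prime := ⟨p.2⟩
  have hmin := hψ.isMinimalNormal_range_inl
  have hVn := range_inl_normal (ψ := ψ)
  intro hle
  have hnorm : piNorm 𝔉 πᶜ (V ⋊[ψ] G) ≠ ⊥ := fun h => hmin.ne_bot (le_bot_iff.1
    (hle.trans (iSup_le fun i => (h𝔉.piNormSeries_eq_bot h i).le)))
  have hVN := hψ.range_inl_le hinj inferInstance hnorm
  have hO : piRadical πᶜ (V ⋊[ψ] G) = ⊥ := by
    by_contra hne
    have h1 := hψ.range_inl_le hinj piRadical_normal hne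
    have h2 : IsPGroup (p : ℕ) (inl : V →* V ⋊[ψ] G).range :=
      hVp.of_surjective _ inl.rangeRestrict_surjective
    have h3 : (p : ℕ) ∣ Nat.card (inl : V →* V ⋊[ψ] G).range :=
      h2.card_eq_or_dvd.resolve_left fun h => hmin.ne_bot (Subgroup.card_eq_one.1 h)
    exact piRadical_mem.2 p (h3.trans (Subgroup.card_dvd_of_le h1)) hp
  refine hR ((Subgroup.eq_bot_iff_forall _).2 fun r hr => ?_)
  refine right_eq_one_of_commute hinj (x := inr r) fun v => ?_
  have h1 := mem_piNorm_iff.1 (hVN ⟨v, rfl⟩) (inr : G →* V ⋊[ψ] G).range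
  rw [hO, sup_bot_eq, h𝔉.subgroupResidual_range] at h1
  obtain ⟨s, -, hs⟩ := (Subgroup.mem_normalizer_iff.1 h1 (inr r)).1 (Subgroup.mem_map_of_mem _ hr)
  -- Conjugation by an element of `V` does not change the component in `G`.
  have hsr : s = r := by
    have := congrArg right hs
    simpa using this
  rw [hsr] at hs
  exact eq_mul_inv_iff_mul_eq.1 hs

/-- A failure of the boundary condition yields a solvable group in which the intersection of the
maximal `𝔑_π ∘ 𝔉`-subgroups is contained neither in the norm series nor in the hypercentre. -/
theorem IsFormation.exists_intMaximal_not_le (h𝔉 : 𝔉.IsFormation) (hS : 𝔉.IsSubgroupClosed)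
    {p : Nat.Primes} (hp : p ∈ π) (hcrit : IsSCritical (formationProduct (piGroups {p}) 𝔉) G)
    (hsol : solvable.Mem G) (hX : ¬ (formationProduct (piNilpotent π) 𝔉).Mem G) :
    ∃ (T : Type u) (_ : Group T), solvable.Mem T ∧
      ¬ intMaximal (formationProduct (piNilpotent π) 𝔉) T ≤ piNormInfty 𝔉 πᶜ T ∧
      ¬ intMaximal (formationProduct (piNilpotent π) 𝔉) T ≤
        piHypercentre (formationProduct nilpotent 𝔉) π T := by
  obtain ⟨_, _⟩ := hsol
  obtain ⟨H, _, V, _, ψ, _, hcrit, hX, _, hVp, _, hψ, hinj⟩ :=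
    h𝔉.exists_faithful_irreducible hcrit hX
  have : Finite H := hcrit.1
  have hfin := finite_semidirectProduct (ψ := ψ)
  have hsolT : Group.IsSolvable (V ⋊[ψ] H) := Group.isSolvable_of_ker_le_range
    (SemidirectProduct.inl : V →* V ⋊[ψ] H) SemidirectProduct.rightHom
    SemidirectProduct.range_inl_eq_ker_rightHom.ge
  have hR : 𝔉.residual H ≠ ⊥ := fun h =>
    hcrit.2.1 (mem_pGroups_product_iff.2 (by rw [h]; exact IsPGroup.of_bot))
  have hle := h𝔉.range_inl_le_intMaximal (ψ := ψ) hVp hcrit hX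
  exact ⟨V ⋊[ψ] H, inferInstance, ⟨hfin, hsolT⟩,
    fun h => h𝔉.range_inl_not_le_piNormInfty hp hVp hψ hinj hR (hle.trans h),
    fun h => h𝔉.range_inl_not_le_piHypercentre hS hp hVp hψ hinj hR (hle.trans h)⟩

end Semidirect

end GroupClass

theorem theoremE (𝔉 : GroupClass.{u}) (h𝔉 : 𝔉.IsFormation) (hS : 𝔉.IsSubgroupClosed)
    (π : Set Nat.Primes) :
    List.TFAE [
      ∀ (G : Type u) [Group G], GroupClass.solvable.Mem G →
        GroupClass.piNormInfty 𝔉 πᶜ G =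
          GroupClass.intMaximal (GroupClass.formationProduct (GroupClass.piNilpotent π) 𝔉) G,
      ∀ (G : Type u) [Group G], GroupClass.solvable.Mem G →
        GroupClass.piHypercentre (GroupClass.formationProduct GroupClass.nilpotent 𝔉) π G =
          GroupClass.intMaximal (GroupClass.formationProduct (GroupClass.piNilpotent π) 𝔉) G,
      GroupClass.BoundaryConditionIIISolvable 𝔉 π] := by
  tfae_have 1 → 3 := by
    intro h p hp G _ hcrit hsol
    by_contra hX
    obtain ⟨T, _, hT, h1, -⟩ := h𝔉.exists_intMaximal_not_le hS hp hcrit hsol hX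
    exact h1 (h T hT).ge
  tfae_have 2 → 3 := by
    intro h p hp G _ hcrit hsol
    by_contra hX
    obtain ⟨T, _, hT, -, h2⟩ := h𝔉.exists_intMaximal_not_le hS hp hcrit hsol hX
    exact h2 (h T hT).ge
  tfae_have 3 → 1 := by
    rintro h G _ ⟨_, _⟩
    exact le_antisymm h𝔉.piNormInfty_le_intMaximal
      ((le_sSup (h𝔉.isPiHypercentral_intMaximal hS h)).trans (h𝔉.piHypercentre_le_piNormInfty hS))
  tfae_have 3 → 2 := by
    rintro h G _ ⟨_, _⟩
    exact le_antisymm ((h𝔉.piHypercentre_le_piNormInfty hS).trans h𝔉.piNormInfty_le_intMaximal)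
      (le_sSup (h𝔉.isPiHypercentral_intMaximal hS h))
  tfae_finish
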